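/- **Quantum Sylvester theorem.** For $n\ge 0$ let $\mathrm{Y}(n)=\mathrm{Y}(\mathfrak{gl}_n)$ be the Yangian: the unital associative $\mathbb{C}$-algebra with generators $t_{ij}^{(r)}$, $1\le i,j\le n$, $r\ge 1$, and the defining relations $$[t^{(r+1)}_{ij},t^{(s)}_{kl}]-[t^{(r)}_{ij},t^{(s+1)}_{kl}]=t^{(r)}_{kj}t^{(s)}_{il}-t^{(s)}_{kj}t^{(r)}_{il},\qquad r,s\ge 0,\quad t^{(0)}_{ij}=\delta_{ij}.$$ Put $t_{ij}(u)=\sum_{r\ge 0}t_{ij}^{(r)}u^{-r}\in \mathrm{Y}(n)[[u^{-1}]]$ and $T(u)=(t_{ij}(u))$. For an $N\times N$ matrix $M(u)$ of formal series in $u^{-1}$ with coefficients in an associative $\mathbb{C}$-algebra $\mathcal{A}$, let $M_a(u)\in\mathcal{A}[[u^{-1}]]\otimes(\mathrm{End}\,\mathbb{C}^N)^{\otimes k}$ be $M(u)$ acting on the $a$-th tensor factor, and let $A_k$ be the antisymmetrizer $e_{i_1}\otimes\cdots\otimes e_{i_k}\mapsto\sum_{\sigma\in\mathfrak{S}_k}\mathrm{sgn}\,\sigma\;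 e_{i_{\sigma(1)}}\otimes\cdots\otimes e_{i_{\sigma(k)}}$. The quantum minor $m^{c_1\cdots c_k}_{d_1\cdots d_k}(u)$ of $M(u)$ is the coefficient of $e_{c_1d_1}\otimes\cdots\otimes e_{c_kd_k}$ in $A_kM_1(u)M_2(u-1)\cdots M_k(u-k+1)$ (here $f(u-a)$ is expanded as a series in $u^{-1}$); for $M=T$ the quantum minors are written $t^{c_1\cdots c_k}_{d_1\cdots d_k}(u)$. The quantum determinant $\mathrm{qdet}\,M(u)$ is the series $D(u)$, unique if it exists and then equal to the quantum minor $m^{1\cdots N}_{1\cdots N}(u)$, such that $$A_NM_1(u)\cdots M_N(u-N+1)=M_N(u-N+1)\cdots M_1(u)A_N=A_N\,D(u).$$ Let $1\le m\le n$, let $\mathcal{B}=\{m+1,\dots,n\}$, let $T(u)_{\mathcal{B}\mathcal{B}}$ be the submatrix of $T(u)$ with rows and columns in $\mathcal{B}$, and let $\widetilde T(u)=(\widetilde t_{ij}(u))$ be the $m\times m$ matrix over $\mathrm{Y}(n)[[u^{-1}]]$ with entries $\widetilde t_{ij}(u)=t^{\,i,m+1,\dots,n}_{\,j,m+1,\dots,n}(u)$,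 $1\le i,j\le m$. Then: 1. There is a (unique) homomorphism of unital $\mathbb{C}$-algebras $\mathrm{Y}(m)\to\mathrm{Y}(n)$ which maps $t_{ij}(u)$ to $\widetilde t_{ij}(u)$, coefficient by coefficient, for all $1\le i,j\le m$. 2. The matrices $T(u)$, $T(u)_{\mathcal{B}\mathcal{B}}$ and $\widetilde T(u)$ have quantum determinants, and $$\mathrm{qdet}\,\widetilde T(u)=\mathrm{qdet}\,T(u)\;\mathrm{qdet}\,T(u-1)_{\mathcal{B}\mathcal{B}}\,\cdots\,\mathrm{qdet}\,T(u-m+1)_{\mathcal{B}\mathcal{B}}$$ (for $m=1$ the right-hand side is $\mathrm{qdet}\,T(u)$; the quantum determinant of the empty matrix is $1$). -/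

import Mathlib

open scoped PowerSeries

/-- Generators of the Yangian at the level of the free algebra: `t_{ij}^{(0)} = δ_{ij}`, and
`t_{ij}^{(r+1)}` is the free generator labelled by `(i, j, r)`. -/
def Yangian.freeGen (n : ℕ) (i j : Fin n) : ℕ → FreeAlgebra ℂ (Fin n × Fin n × ℕ)
  | 0 => if i = j then 1 else 0
  | r + 1 => FreeAlgebra.ι ℂ (i, j, r)

/-- The defining relations of the Yangian for `𝔤𝔩ₙ`: for all `r, s ≥ 0`,
`[t_{ij}^{(r+1)}, t_{kl}^{(s)}] - [t_{ij}^{(r)}, t_{kl}^{(s+1)}]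
  = t_{kj}^{(r)} t_{il}^{(s)} - t_{kj}^{(s)} t_{il}^{(r)}`. -/
inductive Yangian.Rel (n : ℕ) :
    FreeAlgebra ℂ (Fin n × Fin n × ℕ) → FreeAlgebra ℂ (Fin n × Fin n × ℕ) → Prop
  | mk (i j k l : Fin n) (r s : ℕ) :
      Yangian.Rel n
        (⁅freeGen n i j (r + 1), freeGen n k l s⁆ - ⁅freeGen n i j r, freeGen n k l (s + 1)⁆)
        (freeGen n k j r * freeGen n i l s - freeGen n k j s * freeGen n i l r)

/-- The Yangian `Y(n) = Y(𝔤𝔩ₙ)`: the unital associative `ℂ`-algebra with generators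
`t_{ij}^{(r)}`, `r ≥ 1`, and the defining relations `Yangian.Rel`. -/
abbrev Yangian (n : ℕ) : Type := RingQuot (Yangian.Rel n)

namespace Yangian

/-- The element `t_{ij}^{(r)}` of `Y(n)`, with `t_{ij}^{(0)} = δ_{ij}`. -/
noncomputable def t (n : ℕ) (i j : Fin n) (r : ℕ) : Yangian n :=
  RingQuot.mkAlgHom ℂ (Rel n) (freeGen n i j r)

/-- The matrix `T(u)`, whose `ij`-th entry is `t_{ij}(u) = ∑_r t_{ij}^{(r)} u^{-r}`.
Formal series in `u⁻¹` are power series, the variable `X` standing for `u⁻¹`. -/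
noncomputable def T (n : ℕ) : Matrix (Fin n) (Fin n) (Yangian n)⟦X⟧ :=
  Matrix.of fun i j => PowerSeries.mk fun r => t n i j r

section QuantumMinors

variable {A : Type*} [Ring A] [Algebra ℂ A]

/-- The series `f(u - a)` for a series `f(u) = ∑_r f_r u^{-r}` in `u⁻¹`: the variable `X = u⁻¹`
is replaced by `(u - a)⁻¹ = X (1 - a X)⁻¹`. The sum over `r` may be cut off at `N`, because
`X (1 - a X)⁻¹` is divisible by `X`. -/
noncomputable def shift (a : ℂ) (f : A⟦X⟧) : A⟦X⟧ :=
  PowerSeries.mk fun N => ∑ r ∈ Finset.range (N + 1),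
    PowerSeries.coeff N
      (((PowerSeries.X : ℂ⟦X⟧) * (1 - PowerSeries.C a * PowerSeries.X)⁻¹) ^ r) •
        PowerSeries.coeff r f

/-- `M_a` for a matrix `M` of size `n`: the matrix `M` acting on the `a`-th copy of
`End ℂⁿ` in the algebra `R ⊗ (End ℂⁿ)^{⊗ k}`. The latter is the algebra of matrices over `R` whose
rows and columns are labelled by the basis `e_{c_1} ⊗ ⋯ ⊗ e_{c_k}` of `(ℂⁿ)^{⊗ k}`. -/
def leg {R : Type*} [Ring R] {n k : ℕ} (a : Fin k) (M : Matrix (Fin n) (Fin n) R) :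
    Matrix (Fin k → Fin n) (Fin k → Fin n) R :=
  Matrix.of fun c d => if ∀ b, b ≠ a → c b = d b then M (c a) (d a) else 0

/-- The antisymmetrizer `A_k` on `(ℂⁿ)^{⊗ k}`, which maps `e_{d_1} ⊗ ⋯ ⊗ e_{d_k}` to
`∑_σ sgn σ · e_{d_{σ(1)}} ⊗ ⋯ ⊗ e_{d_{σ(k)}}`; the `(c, d)` entry is the coefficient of
`e_{c_1} ⊗ ⋯ ⊗ e_{c_k}` in the image of `e_{d_1} ⊗ ⋯ ⊗ e_{d_k}`. -/
def antisymmetrizer (R : Type*) [Ring R] (n k : ℕ) :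
    Matrix (Fin k → Fin n) (Fin k → Fin n) R :=
  Matrix.of fun c d =>
    ∑ σ : Equiv.Perm (Fin k), if c = d ∘ σ then ((Equiv.Perm.sign σ : ℤ) : R) else 0

/-- The list `M_1(u), M_2(u - 1), …, M_k(u - k + 1)` of elements of
`A[[u⁻¹]] ⊗ (End ℂⁿ)^{⊗ k}`. -/
noncomputable def legs {n : ℕ} (k : ℕ) (M : Matrix (Fin n) (Fin n) A⟦X⟧) :
    List (Matrix (Fin k → Fin n) (Fin k → Fin n) A⟦X⟧) :=
  List.ofFn fun a : Fin k => leg a (M.map (shift ((a : ℕ) : ℂ)))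

/-- The quantum minor `m^{c_1 ⋯ c_k}_{d_1 ⋯ d_k}(u)` of the matrix `M(u)`: the coefficient of
`e_{c_1 d_1} ⊗ ⋯ ⊗ e_{c_k d_k}` in `A_k M_1(u) ⋯ M_k(u - k + 1)`. -/
noncomputable def quantumMinor {n k : ℕ} (M : Matrix (Fin n) (Fin n) A⟦X⟧)
    (c d : Fin k → Fin n) : A⟦X⟧ :=
  (antisymmetrizer A⟦X⟧ n k * (legs k M).prod) c d

/-- `D(u)` is the quantum determinant of the `n × n` matrix `M(u)`:
`A_n M_1(u) ⋯ M_n(u - n + 1) = M_n(u - n + 1) ⋯ M_1(u) A_n = A_n D(u)`. -/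
def IsQuantumDet {n : ℕ} (M : Matrix (Fin n) (Fin n) A⟦X⟧) (D : A⟦X⟧) : Prop :=
  antisymmetrizer A⟦X⟧ n n * (legs n M).prod = D • antisymmetrizer A⟦X⟧ n n ∧
    (legs n M).reverse.prod * antisymmetrizer A⟦X⟧ n n = D • antisymmetrizer A⟦X⟧ n n

/-- The quantum determinant `qdet M(u)` of an `n × n` matrix: the quantum minor with upper and lower
indices `1, …, n`. By `IsQuantumDet.eq_qdet` below it is the only candidate for a series `D(u)`
with `IsQuantumDet M D`. -/
noncomputable def qdet {n : ℕ} (M : Matrix (Fin n) (Fin n) A⟦X⟧) : A⟦X⟧ :=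
  quantumMinor M id id

theorem IsQuantumDet.eq_qdet {n : ℕ} {M : Matrix (Fin n) (Fin n) A⟦X⟧} {D : A⟦X⟧}
    (h : IsQuantumDet M D) : D = qdet M := by
  have h1 := congrFun (congrFun h.1 id) id
  have h2 : antisymmetrizer A⟦X⟧ n n id id = 1 := by
    have h3 : ∀ σ : Equiv.Perm (Fin n), ((id : Fin n → Fin n) = ⇑σ) ↔ σ = 1 := fun σ =>
      ⟨fun hs => Equiv.ext fun x => (congrFun hs x).symm, fun hs => by rw [hs]; rfl⟩
    simp [antisymmetrizer, h3]
  rw [Matrix.smul_apply, h2] at h1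
  simpa [qdet, quantumMinor] using h1.symm

end QuantumMinors

/-- The tuple `(m+1, …, n)` of the elements of `B`, in increasing order. -/
def tupleB {m n : ℕ} (h : m ≤ n) (b : Fin (n - m)) : Fin n :=
  ⟨m + b, by omega⟩

/-- The tuple `(i, m+1, …, n)` for an index `1 ≤ i ≤ m`. -/
def tupleConsB {m n : ℕ} (h : m ≤ n) (i : Fin m) : Fin (n - m + 1) → Fin n :=
  Fin.cons (Fin.castLE h i) (tupleB h)

/-- The `m × m` matrix `T̃(u)` with the entries `t̃_{ij}(u) = t^{i,m+1,…,n}_{j,m+1,…,n}(u)`. -/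
noncomputable def Ttilde {m n : ℕ} (h : m ≤ n) : Matrix (Fin m) (Fin m) (Yangian n)⟦X⟧ :=
  Matrix.of fun i j => quantumMinor (T n) (tupleConsB h i) (tupleConsB h j)

/-- The submatrix `T(u)_{BB}` of `T(u)`, where `B = {m+1, …, n}`. -/
noncomputable def TBB {m n : ℕ} (h : m ≤ n) :
    Matrix (Fin (n - m)) (Fin (n - m)) (Yangian n)⟦X⟧ :=
  (T n).submatrix (tupleB h) (tupleB h)

end Yangian

/-! Let τ be the substitution u ↦ u − 1. A quantum minor is a column-ordered determinant whose
factors carry increasing powers of τ. The Yangian relation at v = u − 1 says that T(u), followed by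
τ, is a Manin matrix. Attach to column j the form ∑ ξ_i ⊗ t_ij with exterior generators ξ_i: these
forms anticommute for the τ-twisted product, and a minor is the top coefficient of a product of such
forms (`skewMinor_eq_extTop`).

Gaussian elimination therefore works. Let A = {1, …, m}, k = n − m, g = qdet T_BB, and let s = T_AA
− T_AB T_BB⁻¹ T_BA be the Schur complement. After the columns B, a column of A may be replaced by
the corresponding column of s, so minors containing B factor (`skewMinor_append`): t̃_ij(u) = g(u)
s_ij(u − k) and qdet T(u) = g(u) qdet s(u − k).

The matrix s is the inverse of the A-block of T⁻¹. Inverting a matrix changes the sign of the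
spectral parameters in the Yangian relation, so after two inversions s satisfies it again; moreover
s commutes with T_BB (`IsRTT.exists_schurComplement`). The coefficients of g commute with each other
and with s, so T̃ = g(u) s(u − k) satisfies the relation too, which gives the homomorphism. Taking g
out of the m columns gives qdet T̃(u) = g(u) g(u − 1) ⋯ g(u − m + 1) qdet s(u − k), and g(u) qdet
s(u − k) is qdet T(u).

The second equation for a quantum determinant is the same theory for the transpose over the opposite
ring; row and column determinants agree by induction on the size (`IsRTT.qdet_induction`). -/

namespace Yangian

/-! ### The substitution u ↦ u − a as an algebra endomorphism -/

section Shift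

variable {A : Type*} [Ring A] [Algebra ℂ A]

/-- The expansion `X (1 - a X)⁻¹` of `(u - a)⁻¹` in `X = u⁻¹`. -/
noncomputable def shiftVar (a : ℂ) : ℂ⟦X⟧ :=
  (PowerSeries.X : ℂ⟦X⟧) * (1 - PowerSeries.C a * PowerSeries.X)⁻¹

theorem one_sub_mul_shiftVar (a : ℂ) :
    (1 - PowerSeries.C a * PowerSeries.X) * shiftVar a = PowerSeries.X := by
  rw [shiftVar, mul_left_comm, PowerSeries.mul_inv_cancel _ (by simp), mul_one]

theorem coeff_shiftVar_pow_of_lt (a : ℂ) {N r : ℕ} (h : N < r) :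
    PowerSeries.coeff N (shiftVar a ^ r) = 0 := by
  rw [shiftVar, mul_pow, PowerSeries.coeff_X_pow_mul', if_neg (by omega)]

/-- Terms with r > N vanish because `shiftVar a` is divisible by X. A free cut-off K lets
coefficients of different degrees be summed over one range. -/
theorem coeff_shift (a : ℂ) (f : A⟦X⟧) {N K : ℕ} (h : N ≤ K) :
    PowerSeries.coeff N (shift a f) =
      ∑ r ∈ Finset.range (K + 1), PowerSeries.coeff N (shiftVar a ^ r) • PowerSeries.coeff r f := by
  rw [shift, PowerSeries.coeff_mk]
  refine Finset.sum_subset (Finset.range_mono (by omega)) fun r _ hr => ?_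
  have h1 := coeff_shiftVar_pow_of_lt a (N := N) (r := r) (by simpa using hr)
  rw [shiftVar] at h1
  rw [h1, zero_smul]

theorem sum_range_antidiagonal {G : Type*} [AddCommMonoid G] (N : ℕ) (h : ℕ → ℕ → G)
    (h0 : ∀ p q, N < p + q → h p q = 0) :
    ∑ r ∈ Finset.range (N + 1), ∑ x ∈ Finset.HasAntidiagonal.antidiagonal r, h x.1 x.2 =
      ∑ p ∈ Finset.range (N + 1), ∑ q ∈ Finset.range (N + 1), h p q := by
  rw [Finset.sum_sigma', ← Finset.sum_product']
  refine Finset.sum_bij_ne_zero (fun x _ _ => x.2) ?_ ?_ ?_ ?_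
  · rintro ⟨r, p, q⟩ h1 _
    simp only [Finset.mem_sigma, Finset.mem_range, Finset.HasAntidiagonal.mem_antidiagonal,
      Finset.mem_product] at h1 ⊢
    omega
  · rintro ⟨r, p, q⟩ h1 _ ⟨r', p', q'⟩ h1' _ he
    simp only [Finset.mem_sigma, Finset.mem_range, Finset.HasAntidiagonal.mem_antidiagonal,
      Prod.mk.injEq] at *
    obtain ⟨rfl, rfl⟩ := he
    obtain rfl : r = r' := by omega
    rfl
  · rintro ⟨p, q⟩ _ h2
    have : ¬ N < p + q := fun hlt => h2 (h0 p q hlt)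
    exact ⟨⟨p + q, p, q⟩, by simp; omega, h2, rfl⟩
  · intros; rfl

theorem shift_mul (a : ℂ) (f g : A⟦X⟧) : shift a (f * g) = shift a f * shift a g := by
  ext N
  rw [coeff_shift a _ le_rfl, PowerSeries.coeff_mul]
  have h1 : ∀ x ∈ Finset.HasAntidiagonal.antidiagonal N,
      PowerSeries.coeff x.1 (shift a f) * PowerSeries.coeff x.2 (shift a g) =
        ∑ p ∈ Finset.range (N + 1), ∑ q ∈ Finset.range (N + 1),
          (PowerSeries.coeff x.1 (shiftVar a ^ p) * PowerSeries.coeff x.2 (shiftVar a ^ q)) •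
            (PowerSeries.coeff p f * PowerSeries.coeff q g) := by
    intro x hx
    rw [Finset.HasAntidiagonal.mem_antidiagonal] at hx
    rw [coeff_shift a f (K := N) (by omega), coeff_shift a g (K := N) (by omega),
      Finset.sum_mul_sum]
    simp only [smul_mul_smul_comm]
  rw [Finset.sum_congr rfl h1, Finset.sum_comm]
  have h2 := sum_range_antidiagonal N (fun p q => PowerSeries.coeff N (shiftVar a ^ (p + q)) •
      (PowerSeries.coeff p f * PowerSeries.coeff q g))
      (fun p q h => by rw [coeff_shiftVar_pow_of_lt a h, zero_smul])
  calc _ = ∑ r ∈ Finset.range (N + 1), ∑ x ∈ Finset.HasAntidiagonal.antidiagonal r,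
        PowerSeries.coeff N (shiftVar a ^ (x.1 + x.2)) •
          (PowerSeries.coeff x.1 f * PowerSeries.coeff x.2 g) := by
        refine Finset.sum_congr rfl fun r _ => ?_
        rw [PowerSeries.coeff_mul, Finset.smul_sum]
        refine Finset.sum_congr rfl fun x hx => ?_
        rw [Finset.HasAntidiagonal.mem_antidiagonal.mp hx]
    _ = _ := by
        rw [h2]
        refine Finset.sum_congr rfl fun p _ => ?_
        rw [Finset.sum_comm]
        refine Finset.sum_congr rfl fun q _ => ?_
        rw [← Finset.sum_smul, pow_add, PowerSeries.coeff_mul]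

theorem shift_C (a : ℂ) (x : A) : shift a (PowerSeries.C x) = PowerSeries.C x := by
  ext N
  rw [coeff_shift a _ le_rfl, Finset.sum_eq_single 0]
  · simp only [pow_zero, PowerSeries.coeff_one, PowerSeries.coeff_C, if_true]
    split_ifs <;> simp
  · intro r _ hr
    simp [PowerSeries.coeff_C, hr]
  · simp

theorem shift_add (a : ℂ) (f g : A⟦X⟧) : shift a (f + g) = shift a f + shift a g := by
  ext N
  simp only [map_add, coeff_shift a _ le_rfl, smul_add, Finset.sum_add_distrib]

/-- `f(u) ↦ f(u - a)` as an algebra homomorphism. -/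
noncomputable def shiftHom (A : Type*) [Ring A] [Algebra ℂ A] (a : ℂ) : A⟦X⟧ →ₐ[ℂ] A⟦X⟧ where
  toFun := shift a
  map_one' := by simpa using shift_C a (1 : A)
  map_mul' := shift_mul a
  map_zero' := by simpa using shift_C a (0 : A)
  map_add' := shift_add a
  commutes' z := by
    rw [PowerSeries.algebraMap_apply]
    exact shift_C a _

@[simp] theorem shiftHom_apply (a : ℂ) (f : A⟦X⟧) : shiftHom A a f = shift a f := rfl

theorem shift_map {A' : Type*} [Ring A'] [Algebra ℂ A'] (a : ℂ) (φ : A →ₐ[ℂ] A') (f : A⟦X⟧) :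
    shift a (PowerSeries.map (φ : A →+* A') f) = PowerSeries.map (φ : A →+* A') (shift a f) := by
  ext N
  simp [coeff_shift a _ le_rfl]

theorem shift_X_complex (a : ℂ) : shift a (PowerSeries.X : ℂ⟦X⟧) = shiftVar a := by
  ext N
  rw [coeff_shift a _ (Nat.le_succ N), Finset.sum_eq_single 1]
  · simp
  · intro r _ hr
    simp [PowerSeries.coeff_X, hr]
  · simp

/-- Both sides expand (u − a − b)⁻¹; they agree after multiplication by 1 − (a + b)X, which is
cancellable in the domain of complex power series. -/
theorem shift_shiftVar (a b : ℂ) : shift a (shiftVar b) = shiftVar (a + b) := by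
  have h1 := congrArg (shiftHom ℂ a) (one_sub_mul_shiftVar b)
  simp only [map_mul, map_sub, map_one, shiftHom_apply, shift_C, shift_X_complex] at h1
  have h2 := one_sub_mul_shiftVar a
  have h3 := one_sub_mul_shiftVar (a + b)
  have hne : (1 - PowerSeries.C (a + b) * PowerSeries.X : ℂ⟦X⟧) ≠ 0 := by
    intro h
    have := congrArg PowerSeries.constantCoeff h
    simp at this
  apply mul_left_cancel₀ hne
  rw [h3, map_add]
  linear_combination (1 - PowerSeries.C a * PowerSeries.X) * h1 +
    (PowerSeries.C b * shift a (shiftVar b) + 1) * h2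

theorem shift_shift (a b : ℂ) (f : A⟦X⟧) : shift a (shift b f) = shift (a + b) f := by
  ext N
  have h1 : ∀ s, PowerSeries.coeff N (shiftVar (a + b) ^ s) = ∑ r ∈ Finset.range (N + 1),
      PowerSeries.coeff N (shiftVar a ^ r) * PowerSeries.coeff r (shiftVar b ^ s) := by
    intro s
    rw [← shift_shiftVar, ← shiftHom_apply, ← map_pow, shiftHom_apply, coeff_shift a _ le_rfl]
    rfl
  rw [coeff_shift a _ le_rfl, coeff_shift (a + b) _ le_rfl]
  simp only [h1, Finset.sum_smul]
  rw [Finset.sum_comm]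
  refine Finset.sum_congr rfl fun r hr => ?_
  rw [coeff_shift b _ (K := N) (by simp at hr; omega), Finset.smul_sum]
  simp only [mul_smul]

theorem shift_zero (f : A⟦X⟧) : shift 0 f = f := by
  ext N
  rw [coeff_shift 0 _ le_rfl, Finset.sum_eq_single N]
  · simp [shiftVar, PowerSeries.coeff_X_pow]
  · intro r _ hr
    simp [shiftVar, PowerSeries.coeff_X_pow, Ne.symm hr]
  · simp

theorem shift_natCast (k : ℕ) (f : A⟦X⟧) : shift (k : ℂ) f = (shiftHom A 1 ^ k) f := by
  induction k with
  | zero => simp [shift_zero]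
  | succ k ih =>
    rw [pow_succ', AlgHom.mul_apply, ← ih, shiftHom_apply, shift_shift]
    push_cast
    rw [add_comm]

theorem one_sub_mul_shift_X (a : ℂ) :
    (1 - PowerSeries.C (algebraMap ℂ A a) * PowerSeries.X) * shift a (PowerSeries.X : A⟦X⟧) =
      PowerSeries.X := by
  have h := congrArg (PowerSeries.map (algebraMap ℂ A)) (one_sub_mul_shiftVar a)
  have h2 := shift_map a (Algebra.ofId ℂ A) (PowerSeries.X : ℂ⟦X⟧)
  rw [shift_X_complex] at h2
  have h3 : ((Algebra.ofId ℂ A : ℂ →ₐ[ℂ] A) : ℂ →+* A) = algebraMap ℂ A := rfl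
  rw [h3, PowerSeries.map_X] at h2
  rw [h2]
  simpa using h

theorem constantCoeff_shift (a : ℂ) (f : A⟦X⟧) :
    PowerSeries.constantCoeff (shift a f) = PowerSeries.constantCoeff f := by
  rw [← PowerSeries.coeff_zero_eq_constantCoeff_apply, coeff_shift a _ le_rfl]
  simp

end Shift

/-! ### Twisted products and twisted anticommutation -/

section SkewProd

variable {Q : Type*} [Ring Q] [Algebra ℂ Q]

/-- The twisted product `x₀ τ(x₁) τ²(x₂) ⋯` of a list. -/
def skewProd (τ : Q →ₐ[ℂ] Q) : List Q → Q
  | [] => 1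
  | x :: l => x * τ (skewProd τ l)

@[simp] theorem skewProd_nil (τ : Q →ₐ[ℂ] Q) : skewProd τ [] = 1 := rfl

@[simp] theorem skewProd_cons (τ : Q →ₐ[ℂ] Q) (x : Q) (l : List Q) :
    skewProd τ (x :: l) = x * τ (skewProd τ l) := rfl

theorem skewProd_append (τ : Q →ₐ[ℂ] Q) (l l' : List Q) :
    skewProd τ (l ++ l') = skewProd τ l * (τ ^ l.length) (skewProd τ l') := by
  induction l with
  | nil => simp
  | cons x l ih => simp [ih, pow_succ', mul_assoc]

theorem skewProd_ofFn (τ : Q →ₐ[ℂ] Q) {k : ℕ} (f : Fin k → Q) :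
    skewProd τ (List.ofFn f) = (List.ofFn fun a : Fin k => (τ ^ (a : ℕ)) (f a)).prod := by
  induction k with
  | zero => simp
  | succ k ih =>
    simp only [List.ofFn_succ, skewProd_cons, ih, List.prod_cons, map_list_prod, List.map_ofFn]
    simp [Function.comp_def, pow_succ']

/-- The anticommutation hypothesis involves exactly one twist, so it applies only to neighbouring
factors. -/
theorem skewProd_ofFn_swap (τ : Q →ₐ[ℂ] Q) {k : ℕ} (f : Fin (k + 1) → Q)
    (hf : ∀ a b, f a * τ (f b) = -(f b * τ (f a))) (i : Fin k) :
    skewProd τ (List.ofFn (f ∘ Equiv.swap i.castSucc i.succ)) = -skewProd τ (List.ofFn f) := by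
  induction k with
  | zero => exact i.elim0
  | succ k ih =>
    cases i using Fin.cases with
    | zero =>
      have h0 : Equiv.swap (0 : Fin (k + 2)) 1 0 = 1 := Equiv.swap_apply_left _ _
      have h1 : Equiv.swap (0 : Fin (k + 2)) 1 1 = 0 := Equiv.swap_apply_right _ _
      have h2 : ∀ j : Fin k, Equiv.swap (0 : Fin (k + 2)) 1 j.succ.succ = j.succ.succ := fun j =>
        Equiv.swap_apply_of_ne_of_ne (by simp [Fin.ext_iff]) (by simp [Fin.ext_iff])
      simp only [List.ofFn_succ, Function.comp_apply, Fin.castSucc_zero, Fin.succ_zero_eq_one,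
        h0, h1, h2, skewProd_cons, map_mul, ← mul_assoc]
      rw [hf 1 0, neg_mul]
    | succ i =>
      have h0 : Equiv.swap i.succ.castSucc i.succ.succ 0 = 0 :=
        Equiv.swap_apply_of_ne_of_ne (by simp [Fin.ext_iff]) (by simp [Fin.ext_iff])
      have h1 : ∀ j : Fin (k + 1), Equiv.swap i.succ.castSucc i.succ.succ j.succ =
          (Equiv.swap i.castSucc i.succ j).succ := by
        intro j
        rw [← Fin.succ_castSucc]
        exact ((Fin.succ_injective _).map_swap _ _ _).symm
      have h2 := ih (f ∘ Fin.succ) (fun a b => hf _ _) i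
      rw [List.ofFn_succ, List.ofFn_succ (f := f)]
      simp only [Function.comp_apply, h0, h1, skewProd_cons]
      have h3 : (List.ofFn fun j : Fin (k + 1) => f (Equiv.swap i.castSucc i.succ j).succ) =
        List.ofFn ((f ∘ Fin.succ) ∘ Equiv.swap i.castSucc i.succ) := rfl
      rw [h3, h2, map_neg, mul_neg]
      rfl

/-- Adjacent transpositions generate the symmetric group, even as a monoid. -/
theorem sign_smul_of_swap {G : Type*} [AddCommGroup G] {X : Type*} {k : ℕ} (F : (Fin k → X) → G)
    (hF : ∀ (i j : Fin k) (d : Fin k → X), (j : ℕ) = i + 1 → F (d ∘ Equiv.swap i j) = -F d)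
    (π : Equiv.Perm (Fin k)) (d : Fin k → X) :
    F (d ∘ π) = (Equiv.Perm.sign π : ℤ) • F d := by
  cases k with
  | zero => simp [Subsingleton.elim π 1]
  | succ k =>
    have hπ : π ∈ Submonoid.closure
        (Set.range fun i : Fin k => Equiv.swap i.castSucc i.succ) := by
      rw [Equiv.Perm.mclosure_swap_castSucc_succ]; trivial
    induction hπ using Submonoid.closure_induction generalizing d with
    | mem x hx =>
      obtain ⟨i, rfl⟩ := hx
      rw [hF _ _ _ (by simp), Equiv.Perm.sign_swap (by simp [Fin.ext_iff])]
      simp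
    | one => simp
    | mul x y _ _ hx hy =>
      rw [Equiv.Perm.coe_mul, ← Function.comp_assoc, hy, hx, Equiv.Perm.sign_mul, smul_smul,
        mul_comm]
      simp

theorem eq_zero_of_eq_neg_self {G : Type*} [AddCommGroup G] [Module ℂ G] {x : G} (h : x = -x) :
    x = 0 := by
  have h1 : (2 : ℂ) • x = 0 := by rw [two_smul]; nth_rewrite 1 [h]; simp
  exact (smul_eq_zero.mp h1).resolve_left two_ne_zero

/-- Anticommutation brings the two copies of `Ψ c` next to each other, where Ψ τ(Ψ) equals its own
negative. -/
theorem skewProd_mul_eq_zero_of_mem (τ : Q →ₐ[ℂ] Q) {κ : Type*} (Ψ : κ → Q)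
    (hΨ : ∀ a b, Ψ a * τ (Ψ b) = -(Ψ b * τ (Ψ a))) (l : List κ) (c : κ) (hc : c ∈ l) :
    skewProd τ (l.map Ψ) * (τ ^ (l.map Ψ).length) (Ψ c) = 0 := by
  have key : ∀ l : List κ, skewProd τ ((c :: (l ++ [c])).map Ψ) = 0 := by
    intro l
    induction l with
    | nil => simpa using eq_zero_of_eq_neg_self (hΨ c c)
    | cons b l ih =>
      simp only [List.cons_append, List.map_cons, skewProd_cons, map_mul] at ih ⊢
      rw [← mul_assoc, hΨ c b, neg_mul, mul_assoc, ← map_mul, ih]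
      simp
  have h1 : ∀ l : List κ, skewProd τ ((l ++ [c]).map Ψ) =
      skewProd τ (l.map Ψ) * (τ ^ (l.map Ψ).length) (Ψ c) := by
    intro l
    rw [List.map_append, skewProd_append]
    simp
  rw [← h1]
  induction l with
  | nil => simp at hc
  | cons b l ih =>
    by_cases hl : c ∈ l
    · rw [List.cons_append, List.map_cons, skewProd_cons, ih hl, map_zero, mul_zero]
    · obtain rfl : c = b := by simpa [hl] using hc
      exact key l

end SkewProd

/-! ### Minors of Manin matrices through the exterior algebra -/

section Minor

variable {P : Type*} [Ring P] [Algebra ℂ P] (τ : P →ₐ[ℂ] P) {ι κ : Type*}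

/-- The column-ordered minor `∑_σ sgn σ · m_{c(σ 0), d(0)} τ(m_{c(σ 1), d(1)}) ⋯`. -/
def skewMinor (M : Matrix ι κ P) {k : ℕ} (c : Fin k → ι) (d : Fin k → κ) : P :=
  ∑ σ : Equiv.Perm (Fin k),
    (Equiv.Perm.sign σ : ℤ) • skewProd τ (List.ofFn fun a => M (c (σ a)) (d a))

/-- The matrix `M`, followed by the twist `τ`, is a Manin matrix. -/
def IsSkewManin (M : Matrix ι κ P) : Prop :=
  ∀ i k j l, M i j * τ (M k l) - M k j * τ (M i l) = -(M i l * τ (M k j) - M k l * τ (M i j))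

theorem skewMinor_comp_perm_left (M : Matrix ι κ P) {k : ℕ} (c : Fin k → ι) (d : Fin k → κ)
    (π : Equiv.Perm (Fin k)) :
    skewMinor τ M (c ∘ π) d = (Equiv.Perm.sign π : ℤ) • skewMinor τ M c d := by
  rw [skewMinor, skewMinor, Finset.smul_sum]
  refine Fintype.sum_equiv (Equiv.mulLeft π) _ _ fun σ => ?_
  rw [smul_smul, Equiv.coe_mulLeft, Equiv.Perm.sign_mul]
  have h : ((Equiv.Perm.sign π : ℤˣ) : ℤ) * (Equiv.Perm.sign π : ℤˣ) = 1 := by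
    rw [← Units.val_mul, Int.units_mul_self, Units.val_one]
  rw [Units.val_mul, ← mul_assoc, h, one_mul]
  rfl

/-- The exterior algebra on `n` generators with coefficients in `P`. -/
abbrev ExtCoeff (P : Type*) [Ring P] [Algebra ℂ P] (n : ℕ) : Type _ :=
  TensorProduct ℂ (ExteriorAlgebra ℂ (Fin n → ℂ)) P

/-- The generators of the exterior algebra. -/
noncomputable def extGen {n : ℕ} (i : Fin n) : ExteriorAlgebra ℂ (Fin n → ℂ) :=
  ExteriorAlgebra.ι ℂ (Pi.single i 1)

theorem extGen_mul_comm {n : ℕ} (i j : Fin n) : extGen i * extGen j = -(extGen j * extGen i) :=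
  eq_neg_of_add_eq_zero_left (ExteriorAlgebra.ι_add_mul_swap _ _)

/-- The twist `τ` acting on the coefficients. -/
noncomputable def extMap (n : ℕ) : ExtCoeff P n →ₐ[ℂ] ExtCoeff P n :=
  Algebra.TensorProduct.map (AlgHom.id ℂ _) τ

@[simp] theorem extMap_tmul (n : ℕ) (x : ExteriorAlgebra ℂ (Fin n → ℂ)) (p : P) :
    extMap τ n (x ⊗ₜ p) = x ⊗ₜ τ p := rfl

@[simp] theorem extMap_pow_tmul (n r : ℕ) (x : ExteriorAlgebra ℂ (Fin n → ℂ)) (p : P) :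
    (extMap τ n ^ r) (x ⊗ₜ p) = x ⊗ₜ (τ ^ r) p := by
  induction r with
  | zero => simp
  | succ r ih => simp [pow_succ', ih]

/-- The form `∑_i ξ_i ⊗ m_i`. -/
noncomputable def linForm {n r : ℕ} (ξ : Fin r → ExteriorAlgebra ℂ (Fin n → ℂ)) (m : Fin r → P) :
    ExtCoeff P n :=
  ∑ i, ξ i ⊗ₜ m i

theorem linForm_anticomm {n : ℕ} (M : Matrix ι κ P) (hM : IsSkewManin τ M) (c : Fin n → ι)
    (j l : κ) :
    linForm extGen (fun i => M (c i) j) * extMap τ n (linForm extGen (fun i => M (c i) l)) =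
      -(linForm extGen (fun i => M (c i) l) * extMap τ n (linForm extGen (fun i => M (c i) j))) := by
  have expand : ∀ j l, linForm extGen (fun i => M (c i) j) *
      extMap τ n (linForm extGen (fun i => M (c i) l)) =
      ∑ i, ∑ k, (extGen i * extGen k) ⊗ₜ[ℂ] (M (c i) j * τ (M (c k) l)) := by
    intro j l
    simp only [linForm, map_sum, extMap_tmul, Finset.sum_mul_sum,
      Algebra.TensorProduct.tmul_mul_tmul]
  rw [eq_neg_iff_add_eq_zero, expand, expand]
  simp only [← Finset.sum_add_distrib, ← TensorProduct.tmul_add]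
  -- Exchange i and k: ξ_i ξ_k changes sign, while the Manin relation says that the summed
  -- coefficient is symmetric in i and k. So the sum is its own negative.
  apply eq_zero_of_eq_neg_self
  conv_lhs => rw [Finset.sum_comm]
  rw [← Finset.sum_neg_distrib]
  refine Finset.sum_congr rfl fun i _ => ?_
  rw [← Finset.sum_neg_distrib]
  refine Finset.sum_congr rfl fun k _ => ?_
  rw [extGen_mul_comm k i, TensorProduct.neg_tmul]
  congr 2
  have h := hM (c i) (c k) j l
  rw [sub_eq_iff_eq_add] at h
  rw [h]
  abel

theorem skewProd_linForm {n r k : ℕ} (ξ : Fin r → ExteriorAlgebra ℂ (Fin n → ℂ))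
    (N : Matrix (Fin r) (Fin k) P) :
    skewProd (extMap τ n) (List.ofFn fun a => linForm ξ (fun i => N i a)) =
      ∑ e : Fin k → Fin r,
        (List.ofFn fun a => ξ (e a)).prod ⊗ₜ skewProd τ (List.ofFn fun a => N (e a) a) := by
  induction k with
  | zero => simp [Algebra.TensorProduct.one_def]
  | succ k ih =>
    rw [List.ofFn_succ, skewProd_cons, ih (fun i a => N i a.succ), linForm, map_sum,
      Finset.sum_mul_sum, ← (Fin.consEquiv fun _ => Fin r).sum_comp, Fintype.sum_prod_type]
    simp [Fin.consEquiv]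

/-- The coefficient functional of `ξ_1 ⋯ ξ_n`. -/
noncomputable def topCoeff (n : ℕ) : ExteriorAlgebra ℂ (Fin n → ℂ) →ₗ[ℂ] ℂ :=
  ExteriorAlgebra.liftAlternating (Pi.single n Matrix.detRowAlternating)

theorem topCoeff_prod {n : ℕ} (e : Fin n → Fin n) :
    topCoeff n (List.ofFn fun a => extGen (e a)).prod =
      Matrix.det (Matrix.of fun a j => if e a = j then (1 : ℂ) else 0) := by
  have h : (List.ofFn fun a => extGen (e a)).prod =
      ExteriorAlgebra.ιMulti ℂ n (fun a => Pi.single (e a) (1 : ℂ)) := by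
    rw [ExteriorAlgebra.ιMulti_apply]; rfl
  rw [h, topCoeff, ExteriorAlgebra.liftAlternating_apply_ιMulti, Pi.single_eq_same]
  change Matrix.det _ = _
  congr 1
  ext a j
  simp [Pi.single_apply, eq_comm]

/-- The coefficient of `ξ_1 ⋯ ξ_n` in an element with coefficients in `P`. -/
noncomputable def extTop (P : Type*) [Ring P] [Algebra ℂ P] (n : ℕ) : ExtCoeff P n →ₗ[ℂ] P :=
  (TensorProduct.lid ℂ P).toLinearMap ∘ₗ TensorProduct.map (topCoeff n) LinearMap.id

@[simp] theorem extTop_tmul (n : ℕ) (x : ExteriorAlgebra ℂ (Fin n → ℂ)) (p : P) :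
    extTop P n (x ⊗ₜ p) = topCoeff n x • p := rfl

/-- Expanding the determinant, the term of σ singles out one tuple, e = g ∘ σ⁻¹. This turns the
weights produced by `topCoeff_prod` into a signed sum over permutations. -/
theorem sum_det_smul {G X : Type*} [AddCommGroup G] [Module ℂ G] [Fintype X] [DecidableEq X]
    {k : ℕ} (g : Fin k → X) (F : (Fin k → X) → G) :
    ∑ e : Fin k → X, Matrix.det (Matrix.of fun a j => if e a = g j then (1 : ℂ) else 0) • F e =
      ∑ σ : Equiv.Perm (Fin k), (Equiv.Perm.sign σ : ℤ) • F (g ∘ σ) := by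
  have h1 : ∀ (e : Fin k → X) (σ : Equiv.Perm (Fin k)),
      ∏ i, (Matrix.of fun a j => if e a = g j then (1 : ℂ) else 0) (σ i) i =
        if e = g ∘ ⇑σ⁻¹ then 1 else 0 := by
    intro e σ
    simp only [Matrix.of_apply, Finset.prod_ite_zero, Finset.prod_const_one, Finset.mem_univ,
      true_imp_iff]
    congr 1
    refine propext ⟨fun h => funext fun a => ?_, fun h i => ?_⟩
    · simpa using h (σ⁻¹ a)
    · simp [h]
  simp only [Matrix.det_apply', h1, Finset.sum_smul, mul_ite, mul_one, mul_zero, ite_smul, zero_smul]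
  rw [Finset.sum_comm]
  simp only [Finset.sum_ite_eq', Finset.mem_univ, if_true]
  refine Fintype.sum_equiv (Equiv.inv _) _ _ fun σ => ?_
  simp [Int.cast_smul_eq_zsmul]

theorem skewMinor_eq_extTop (M : Matrix ι κ P) {k : ℕ} (c : Fin k → ι) (d : Fin k → κ) :
    skewMinor τ M c d =
      extTop P k (skewProd (extMap τ k)
        (List.ofFn fun a => linForm extGen (fun i => M (c i) (d a)))) := by
  have h := skewProd_linForm τ extGen (Matrix.of fun i a => M (c i) (d a))
  simp only [Matrix.of_apply] at h
  rw [h, map_sum]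
  simp only [extTop_tmul, topCoeff_prod]
  exact (sum_det_smul id fun e => skewProd τ (List.ofFn fun a => M (c (e a)) (d a))).symm

variable {τ}

/-- Row permutations merely reindex the sum, but column permutations need the Manin property: the
columns are the anticommuting forms. -/
theorem skewMinor_comp_perm_right {M : Matrix ι κ P} (hM : IsSkewManin τ M) {k : ℕ}
    (c : Fin k → ι) (d : Fin k → κ) (π : Equiv.Perm (Fin k)) :
    skewMinor τ M c (d ∘ π) = (Equiv.Perm.sign π : ℤ) • skewMinor τ M c d := by
  refine sign_smul_of_swap (fun d => skewMinor τ M c d) (fun i j d hij => ?_) π d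
  cases k with
  | zero => exact i.elim0
  | succ k =>
    obtain ⟨i, rfl⟩ : ∃ i' : Fin k, i = i'.castSucc := ⟨⟨i, by omega⟩, rfl⟩
    obtain rfl : j = i.succ := by ext; simpa using hij
    simp only [skewMinor_eq_extTop]
    rw [← map_neg, ← skewProd_ofFn_swap _ _ (fun a b => linForm_anticomm τ M hM c _ _)]
    rfl

theorem skewMinor_comp_perm {M : Matrix ι κ P} (hM : IsSkewManin τ M) {k : ℕ}
    (c : Fin k → ι) (d : Fin k → κ) (π : Equiv.Perm (Fin k)) :
    skewMinor τ M (c ∘ π) (d ∘ π) = skewMinor τ M c d := by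
  rw [skewMinor_comp_perm_left, skewMinor_comp_perm_right hM, smul_smul, ← Units.val_mul,
    Int.units_mul_self, Units.val_one, one_smul]

/-- The last m rows are supported in the last m columns, so the matrix is block triangular. -/
theorem det_append {k m : ℕ} (e : Fin k → Fin (k + m)) (f : Fin m → Fin m) :
    Matrix.det (Matrix.of fun a j =>
        if Fin.append e (Fin.natAdd k ∘ f) a = j then (1 : ℂ) else 0) =
      Matrix.det (Matrix.of fun a j => if e a = Fin.castAdd m j then (1 : ℂ) else 0) *
        Matrix.det (Matrix.of fun a j => if f a = j then (1 : ℂ) else 0) := by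
  rw [← Matrix.det_submatrix_equiv_self finSumFinEquiv, ← Matrix.fromBlocks_toBlocks
    (Matrix.submatrix _ _ _)]
  have h : (Matrix.submatrix (Matrix.of fun a j =>
      if Fin.append e (Fin.natAdd k ∘ f) a = j then (1 : ℂ) else 0)
        finSumFinEquiv finSumFinEquiv).toBlocks₂₁ = 0 := by
    ext a j
    simp [Matrix.toBlocks₂₁, Fin.ext_iff]
    omega
  rw [h, Matrix.det_fromBlocks_zero₂₁]
  congr 2
  · ext a j
    simp [Matrix.toBlocks₁₁]
  · ext a j
    simp [Matrix.toBlocks₂₂, Fin.ext_iff]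

/-- Block elimination: if `M_{BA} = M_{BB} x`, then the minor of `M` with the rows `B, c` and the
columns `B, d` is the product of the minor for `B` and the determinant of
`M_{cd} - M_{cB} x`. -/
theorem skewMinor_append {M : Matrix ι ι P} (hM : IsSkewManin τ M) {k m : ℕ}
    (b : Fin k → ι) (c d : Fin m → ι) (x : Matrix (Fin k) (Fin m) P)
    (hx : ∀ β j, M (b β) (d j) = ∑ γ, M (b β) (b γ) * x γ j) :
    skewMinor τ M (Fin.append b c) (Fin.append b d) =
      skewMinor τ M b b * (τ ^ k) (skewMinor τ
        (Matrix.of fun i j => M (c i) (d j) - ∑ γ, M (c i) (b γ) * x γ j) id id) := by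
  set s : Matrix (Fin m) (Fin m) P :=
    Matrix.of fun i j => M (c i) (d j) - ∑ γ, M (c i) (b γ) * x γ j with hs
  set Ψ : ι → ExtCoeff P (k + m) := fun j => linForm extGen (fun i => M (Fin.append b c i) j) with hΨ
  set S : Fin m → ExtCoeff P (k + m) := fun j =>
    linForm (fun i => extGen (Fin.natAdd k i)) (fun i => s i j) with hS
  -- By `hx` the components along the rows `b` cancel, so `S j` involves only the last m exterior
  -- generators. The factor x stands on the right and need not commute with anything.
  have hdec : ∀ j, Ψ (d j) = ∑ γ, Ψ (b γ) * (1 ⊗ₜ x γ j) + S j := by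
    intro j
    simp only [hΨ, hS, linForm, Finset.sum_mul, Algebra.TensorProduct.tmul_mul_tmul, mul_one]
    rw [Finset.sum_comm]
    simp only [Fin.sum_univ_add, Fin.append_left, Fin.append_right, ← TensorProduct.tmul_sum, hx]
    rw [add_assoc, ← Finset.sum_add_distrib]
    congr 1
    refine Finset.sum_congr rfl fun i _ => ?_
    rw [← TensorProduct.tmul_add, hs, Matrix.of_apply, add_sub_cancel]
  have hanti : ∀ i j, Ψ i * extMap τ _ (Ψ j) = -(Ψ j * extMap τ _ (Ψ i)) :=
    linForm_anticomm τ M hM _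
  -- Columns are appended on the right: the product before the new column contains every `Ψ (b γ)`,
  -- hence kills the sum in `hdec` and leaves `S j`.
  have hrep : ∀ l : List (Fin m),
      skewProd (extMap τ _) ((List.ofFn b).map Ψ ++ l.map (fun j => Ψ (d j))) =
        skewProd (extMap τ _) ((List.ofFn b).map Ψ ++ l.map S) := by
    intro l
    induction l using List.reverseRecOn with
    | nil => rfl
    | append_singleton l j ih =>
      have hz : ∀ γ, skewProd (extMap τ _) ((List.ofFn b).map Ψ ++ l.map (fun j => Ψ (d j))) *
          (extMap τ _ ^ ((List.ofFn b).map Ψ ++ l.map (fun j => Ψ (d j))).length) (Ψ (b γ)) = 0 := by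
        intro γ
        have h1 := skewProd_mul_eq_zero_of_mem (extMap τ _) Ψ hanti (List.ofFn b ++ l.map d) (b γ)
          (by simp)
        simpa [Function.comp_def] using h1
      simp only [List.map_append, ← List.append_assoc, List.map_cons, List.map_nil]
      rw [skewProd_append (l' := [Ψ (d j)]), skewProd_append (l' := [S j]), ← ih]
      simp only [skewProd_cons, skewProd_nil, map_one, mul_one]
      rw [hdec j]
      simp only [map_add, map_sum, map_mul, mul_add, Finset.mul_sum]
      simp only [← mul_assoc, hz, zero_mul, Finset.sum_const_zero, zero_add]
      congr 3
      simp
  have hsplit : (List.ofFn fun a => Ψ (Fin.append b d a)) =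
      (List.ofFn b).map Ψ ++ (List.ofFn id).map (fun j => Ψ (d j)) := by
    rw [List.map_ofFn, List.map_ofFn, ← List.ofFn_fin_append]
    congr 1
    ext a
    refine Fin.addCases (fun i => ?_) (fun i => ?_) a <;> simp
  rw [skewMinor_eq_extTop, hsplit, hrep, skewProd_append, List.map_ofFn, List.map_ofFn,
    List.length_ofFn]
  have e1 := skewProd_linForm τ (extGen (n := k + m)) (Matrix.of fun i a => M (Fin.append b c i) (b a))
  have e2 := skewProd_linForm τ (fun i => extGen (Fin.natAdd k i)) s
  simp only [Matrix.of_apply] at e1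
  change extTop P (k + m) (skewProd (extMap τ _) (List.ofFn fun a => Ψ (b a)) *
    (extMap τ _ ^ k) (skewProd (extMap τ _) (List.ofFn fun a => S a))) = _
  rw [e1, e2, map_sum, Finset.sum_mul_sum]
  simp only [extMap_pow_tmul, Algebra.TensorProduct.tmul_mul_tmul, map_sum, extTop_tmul]
  -- The forms S use only the last m generators, so the top coefficient forces the columns `b` to
  -- supply the first k, and it splits into a product.
  have e3 : ∀ (e : Fin k → Fin (k + m)) (f : Fin m → Fin m),
      topCoeff (k + m) ((List.ofFn fun a => extGen (e a)).prod *
        (List.ofFn fun a => extGen (Fin.natAdd k (f a))).prod) =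
      Matrix.det (Matrix.of fun a j => if e a = Fin.castAdd m j then (1 : ℂ) else 0) *
        Matrix.det (Matrix.of fun a j => if f a = j then (1 : ℂ) else 0) := by
    intro e f
    rw [← det_append, ← topCoeff_prod, ← List.prod_append, ← List.ofFn_fin_append]
    congr 3
    ext a
    refine Fin.addCases (fun i => ?_) (fun i => ?_) a <;> simp
  simp only [e3, ← smul_mul_smul_comm, ← Finset.sum_mul_sum]
  congr 1
  · rw [sum_det_smul (Fin.castAdd m)
      fun e => skewProd τ (List.ofFn fun a => M (Fin.append b c (e a)) (b a)), skewMinor]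
    simp
  · simp only [← map_smul, ← map_sum]
    congr 1
    exact sum_det_smul id fun f => skewProd τ (List.ofFn fun a => s (f a) a)

end Minor

/-! ### Alternating functions of index tuples -/

section Alternating

variable {G : Type*} [AddCommGroup G] [Module ℂ G] {n : ℕ}

theorem alternating_eq_zero {X : Type*} {F : (Fin n → X) → G}
    (hF : ∀ (d : Fin n → X) (π : Equiv.Perm (Fin n)), F (d ∘ π) = (Equiv.Perm.sign π : ℤ) • F d)
    {d : Fin n → X} (hd : ¬ Function.Injective d) : F d = 0 := by
  simp only [Function.Injective, not_forall] at hd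
  obtain ⟨a, b, hab, hne⟩ := hd
  apply eq_zero_of_eq_neg_self
  have h := hF d (Equiv.swap a b)
  rw [Equiv.Perm.sign_swap hne] at h
  have h2 : d ∘ Equiv.swap a b = d := by
    ext x
    simp only [Function.comp_apply, Equiv.swap_apply_def]
    split_ifs with h3 h4 <;> simp_all
  rw [h2] at h
  simpa using h

/-- A tuple of length n in n letters either has a repetition, where both functions vanish, or is a
permutation of `id`. -/
theorem biAlternating_ext {F F' : (Fin n → Fin n) → (Fin n → Fin n) → G}
    (hF : ∀ c d (π : Equiv.Perm (Fin n)), F (c ∘ π) d = (Equiv.Perm.sign π : ℤ) • F c d)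
    (hF2 : ∀ c d (π : Equiv.Perm (Fin n)), F c (d ∘ π) = (Equiv.Perm.sign π : ℤ) • F c d)
    (hF' : ∀ c d (π : Equiv.Perm (Fin n)), F' (c ∘ π) d = (Equiv.Perm.sign π : ℤ) • F' c d)
    (hF2' : ∀ c d (π : Equiv.Perm (Fin n)), F' c (d ∘ π) = (Equiv.Perm.sign π : ℤ) • F' c d)
    (h : F id id = F' id id) (c d : Fin n → Fin n) : F c d = F' c d := by
  by_cases hc : Function.Injective c
  · by_cases hd : Function.Injective d
    · obtain ⟨σ, rfl⟩ : ∃ σ : Equiv.Perm (Fin n), c = id ∘ σ :=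
        ⟨Equiv.ofBijective c (Finite.injective_iff_bijective.mp hc), rfl⟩
      obtain ⟨π, rfl⟩ : ∃ π : Equiv.Perm (Fin n), d = id ∘ π :=
        ⟨Equiv.ofBijective d (Finite.injective_iff_bijective.mp hd), rfl⟩
      rw [hF, hF2, hF', hF2', h]
    · rw [alternating_eq_zero (F := F c) (fun d π => hF2 c d π) hd,
        alternating_eq_zero (F := F' c) (fun d π => hF2' c d π) hd]
  · rw [alternating_eq_zero (F := fun c => F c d) (fun c π => hF c d π) hc,
      alternating_eq_zero (F := fun c => F' c d) (fun c π => hF' c d π) hc]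

end Alternating

/-! ### Entries of the antisymmetrizer -/

section Antisymmetrizer

variable (R : Type*) [Ring R] {n k : ℕ}

theorem antisymmetrizer_comp_perm_left (c d : Fin k → Fin n) (π : Equiv.Perm (Fin k)) :
    antisymmetrizer R n k (c ∘ π) d = (Equiv.Perm.sign π : ℤ) • antisymmetrizer R n k c d := by
  simp only [antisymmetrizer, Matrix.of_apply, Finset.smul_sum]
  refine Fintype.sum_equiv (Equiv.mulRight π⁻¹) _ _ fun σ => ?_
  have h : c ∘ π = d ∘ σ ↔ c = d ∘ ⇑(σ * π⁻¹) := by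
    refine ⟨fun h => ?_, fun h => ?_⟩
    · ext x; simpa using congrArg Fin.val (congrFun h (π⁻¹ x))
    · rw [h]; ext x; simp
  simp only [h, Equiv.coe_mulRight, smul_ite, smul_zero, Equiv.Perm.sign_mul, Equiv.Perm.sign_inv]
  congr 1
  rw [Units.val_mul, zsmul_eq_mul, ← Int.cast_mul, mul_left_comm, ← Units.val_mul,
    Int.units_mul_self, Units.val_one, mul_one]

theorem antisymmetrizer_comp_perm_right (c d : Fin k → Fin n) (π : Equiv.Perm (Fin k)) :
    antisymmetrizer R n k c (d ∘ π) = (Equiv.Perm.sign π : ℤ) • antisymmetrizer R n k c d := by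
  simp only [antisymmetrizer, Matrix.of_apply, Finset.smul_sum]
  refine Fintype.sum_equiv (Equiv.mulLeft π) _ _ fun σ => ?_
  simp only [Equiv.coe_mulLeft, smul_ite, smul_zero, Equiv.Perm.sign_mul, Equiv.Perm.coe_mul,
    Function.comp_assoc]
  congr 1
  rw [Units.val_mul, zsmul_eq_mul, ← Int.cast_mul, ← mul_assoc, ← Units.val_mul,
    Int.units_mul_self, Units.val_one, one_mul]

theorem antisymmetrizer_id_id : antisymmetrizer R n n id id = 1 := by
  have h3 : ∀ σ : Equiv.Perm (Fin n), ((id : Fin n → Fin n) = ⇑σ) ↔ σ = 1 := fun σ =>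
    ⟨fun hs => Equiv.ext fun x => (congrFun hs x).symm, fun hs => by rw [hs]; rfl⟩
  simp [antisymmetrizer, h3]

end Antisymmetrizer

/-! ### From tensor legs to twisted minors -/

section Legs

/-- Distinct legs act on distinct tensor factors, so only one intermediate tuple survives in each
matrix product. -/
theorem prod_map_leg {R : Type*} [Ring R] {n k : ℕ} (N : Fin k → Matrix (Fin n) (Fin n) R)
    (l : List (Fin k)) (hl : l.Nodup) (c d : Fin k → Fin n) :
    (l.map fun a => leg a (N a)).prod c d =
      if ∀ b, b ∉ l → c b = d b then (l.map fun a => N a (c a) (d a)).prod else 0 := by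
  induction l generalizing c with
  | nil => simp [Matrix.one_apply, funext_iff]
  | cons a l ih =>
    obtain ⟨ha, hl⟩ := List.nodup_cons.mp hl
    rw [List.map_cons, List.prod_cons, Matrix.mul_apply,
      Finset.sum_eq_single (Function.update c a (d a))]
    · rw [ih hl, leg, Matrix.of_apply, if_pos (fun b hb => by simp [hb])]
      have h1 : (∀ b, b ∉ l → Function.update c a (d a) b = d b) ↔
          ∀ b, b ∉ a :: l → c b = d b := by
        refine forall_congr' fun b => ?_
        by_cases hb : b = a
        · subst hb; simp
        · simp [hb]
      have h2 : (l.map fun b => N b (Function.update c a (d a) b) (d b)) =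
          l.map fun b => N b (c b) (d b) := by
        refine List.map_congr_left fun b hb => ?_
        rw [Function.update_of_ne (by rintro rfl; exact ha hb)]
      simp only [h1, h2, Function.update_self, List.map_cons, List.prod_cons, mul_ite, mul_zero]
    · intro e _ he
      rw [ih hl, leg, Matrix.of_apply]
      split_ifs with h1 h2
      · exact absurd (funext fun b => by
          by_cases hb : b = a
          · subst hb; simpa using h2 b ha
          · simpa [hb] using (h1 b hb).symm) he
      all_goals simp
    · simp

theorem antisymmetrizer_mul_apply {R : Type*} [Ring R] {n k : ℕ}
    (L : Matrix (Fin k → Fin n) (Fin k → Fin n) R) (c d : Fin k → Fin n) :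
    (antisymmetrizer R n k * L) c d =
      ∑ σ : Equiv.Perm (Fin k), (Equiv.Perm.sign σ : ℤ) • L (c ∘ σ) d := by
  simp only [Matrix.mul_apply, antisymmetrizer, Matrix.of_apply, Finset.sum_mul]
  rw [Finset.sum_comm]
  refine Fintype.sum_equiv (Equiv.inv _) _ _ fun σ => ?_
  rw [Finset.sum_eq_single (c ∘ ⇑σ⁻¹)]
  · rw [if_pos (by ext; simp)]
    simp [zsmul_eq_mul]
  · intro e _ he
    rw [if_neg, zero_mul]
    rintro rfl
    exact he (by ext; simp)
  · simp

theorem mul_antisymmetrizer_apply {R : Type*} [Ring R] {n k : ℕ}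
    (L : Matrix (Fin k → Fin n) (Fin k → Fin n) R) (c d : Fin k → Fin n) :
    (L * antisymmetrizer R n k) c d =
      ∑ σ : Equiv.Perm (Fin k), (Equiv.Perm.sign σ : ℤ) • L c (d ∘ σ) := by
  simp only [Matrix.mul_apply, antisymmetrizer, Matrix.of_apply, Finset.mul_sum]
  rw [Finset.sum_comm]
  refine Finset.sum_congr rfl fun σ _ => ?_
  rw [Finset.sum_eq_single (d ∘ σ)]
  · simp only [if_true, zsmul_eq_mul]
    exact ((Int.cast_commute _ _).eq).symm
  · intro e _ he
    rw [if_neg he, mul_zero]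
  · simp

variable {A : Type*} [Ring A] [Algebra ℂ A]

theorem legs_eq_map {n k : ℕ} (M : Matrix (Fin n) (Fin n) A⟦X⟧) :
    legs k M =
      (List.finRange k).map fun a : Fin k => leg a (M.map (shift ((a : ℕ) : ℂ))) := by
  rw [legs, List.ofFn_eq_map]

theorem quantumMinor_eq_skewMinor {n k : ℕ} (M : Matrix (Fin n) (Fin n) A⟦X⟧)
    (c d : Fin k → Fin n) :
    quantumMinor M c d = skewMinor (shiftHom A 1) M c d := by
  rw [quantumMinor, antisymmetrizer_mul_apply, skewMinor, legs_eq_map]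
  refine Finset.sum_congr rfl fun σ _ => ?_
  rw [prod_map_leg _ _ (List.nodup_finRange k), if_pos (fun b hb => absurd (List.mem_finRange b) hb),
    skewProd_ofFn, List.ofFn_eq_map]
  simp only [Matrix.map_apply, shift_natCast]
  rfl

/-- The transpose of a matrix, over the opposite ring. -/
def opTranspose {P ι κ : Type*} (M : Matrix ι κ P) : Matrix κ ι Pᵐᵒᵖ :=
  Matrix.of fun i j => MulOpposite.op (M j i)

theorem op_pow_apply {P : Type*} [Ring P] [Algebra ℂ P] (τ : P →ₐ[ℂ] P) (r : ℕ) (x : P) :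
    (AlgHom.op τ ^ r) (MulOpposite.op x) = MulOpposite.op ((τ ^ r) x) := by
  induction r with
  | zero => simp
  | succ r ih => rw [pow_succ', pow_succ', AlgHom.mul_apply, ih]; rfl

/-- Passing to the opposite ring undoes the reversed order of the legs, so the row-ordered minor
becomes a column-ordered minor of the transpose. -/
theorem op_legs_reverse_mul_antisymmetrizer {n k : ℕ} (M : Matrix (Fin n) (Fin n) A⟦X⟧)
    (c d : Fin k → Fin n) :
    MulOpposite.op (((legs k M).reverse.prod * antisymmetrizer A⟦X⟧ n k) c d) =
      skewMinor (AlgHom.op (shiftHom A 1)) (opTranspose M) d c := by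
  rw [mul_antisymmetrizer_apply, skewMinor, Finset.op_sum, legs_eq_map, ← List.map_reverse]
  refine Finset.sum_congr rfl fun σ _ => ?_
  rw [prod_map_leg _ _ (List.nodup_reverse.mpr (List.nodup_finRange k)),
    if_pos (fun b hb => absurd (List.mem_reverse.mpr (List.mem_finRange b)) hb),
    skewProd_ofFn, List.ofFn_eq_map, MulOpposite.op_smul, MulOpposite.op_list_prod]
  simp only [Matrix.map_apply, shift_natCast, List.map_reverse, List.reverse_reverse, List.map_map]
  congr 2
  refine List.map_congr_left fun a _ => ?_
  simp [opTranspose, -AlgHom.coe_pow, op_pow_apply]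

/-- All matrices involved are alternating in both tuples, so each of the two equations need only be
checked at (id, id). -/
theorem isQuantumDet_qdet {n : ℕ} {M : Matrix (Fin n) (Fin n) A⟦X⟧}
    (hM : IsSkewManin (shiftHom A 1) M)
    (hM' : IsSkewManin (AlgHom.op (shiftHom A 1)) (opTranspose M))
    (h : skewMinor (AlgHom.op (shiftHom A 1)) (opTranspose M) id id =
      MulOpposite.op (skewMinor (shiftHom A 1) M id id)) :
    IsQuantumDet M (qdet M) := by
  have hq : qdet M = skewMinor (shiftHom A 1) M id id := quantumMinor_eq_skewMinor M id id
  constructor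
  · ext1 c d
    change quantumMinor M c d = _
    rw [quantumMinor_eq_skewMinor, Matrix.smul_apply, smul_eq_mul]
    refine biAlternating_ext (F := fun c d => skewMinor (shiftHom A 1) M c d)
      (F' := fun c d => qdet M * antisymmetrizer A⟦X⟧ n n c d)
      (fun c d π => skewMinor_comp_perm_left _ _ _ _ _)
      (fun c d π => skewMinor_comp_perm_right hM _ _ _)
      (fun c d π => ?_) (fun c d π => ?_) ?_ c d
    · simp only [antisymmetrizer_comp_perm_left, mul_smul_comm]
    · simp only [antisymmetrizer_comp_perm_right, mul_smul_comm]
    · simp only [antisymmetrizer_id_id, mul_one, hq]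
  · ext1 c d
    apply MulOpposite.op_injective
    rw [op_legs_reverse_mul_antisymmetrizer, Matrix.smul_apply, smul_eq_mul]
    refine biAlternating_ext
      (F := fun c d => skewMinor (AlgHom.op (shiftHom A 1)) (opTranspose M) d c)
      (F' := fun c d => MulOpposite.op (qdet M * antisymmetrizer A⟦X⟧ n n c d))
      (fun c d π => skewMinor_comp_perm_right hM' _ _ _)
      (fun c d π => skewMinor_comp_perm_left _ _ _ _ _)
      (fun c d π => ?_) (fun c d π => ?_) ?_ c d
    · simp only [antisymmetrizer_comp_perm_left, mul_smul_comm, MulOpposite.op_smul]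
    · simp only [antisymmetrizer_comp_perm_right, mul_smul_comm, MulOpposite.op_smul]
    · simp only [antisymmetrizer_id_id, mul_one, hq, h]

end Legs

/-! ### Series in two variables u⁻¹, v⁻¹ -/

section TwoVariables

variable {A : Type*} [Ring A]

/-- A series in `u⁻¹` as a series in the two variables `u⁻¹`, `v⁻¹`; here `v⁻¹` is the outer
variable. -/
noncomputable def inU : A⟦X⟧ →+* A⟦X⟧⟦X⟧ := PowerSeries.C

/-- A series in `v⁻¹` as a series in the two variables `u⁻¹`, `v⁻¹`. -/
noncomputable def inV : A⟦X⟧ →+* A⟦X⟧⟦X⟧ := PowerSeries.map PowerSeries.C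

/-- The coefficient of `u⁻ʳ v⁻ˢ`. -/
noncomputable def coeffUV (r s : ℕ) : A⟦X⟧⟦X⟧ →+ A :=
  (PowerSeries.coeff r).toAddMonoidHom.comp (PowerSeries.coeff (R := A⟦X⟧) s).toAddMonoidHom

theorem coeffUV_apply (r s : ℕ) (G : A⟦X⟧⟦X⟧) :
    coeffUV r s G = PowerSeries.coeff r (PowerSeries.coeff s G) := rfl

@[simp] theorem coeffUV_inU_mul_inV (r s : ℕ) (f g : A⟦X⟧) :
    coeffUV r s (inU f * inV g) = PowerSeries.coeff r f * PowerSeries.coeff s g := by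
  simp [coeffUV_apply, inU, inV]

@[simp] theorem coeffUV_inV_mul_inU (r s : ℕ) (f g : A⟦X⟧) :
    coeffUV r s (inV g * inU f) = PowerSeries.coeff s g * PowerSeries.coeff r f := by
  simp [coeffUV_apply, inU, inV]

theorem coeffUV_ext {G H : A⟦X⟧⟦X⟧} (h : ∀ r s, coeffUV r s G = coeffUV r s H) : G = H := by
  ext s r
  exact h r s

variable (A) in
/-- The element `v⁻¹ - u⁻¹`. -/
noncomputable def alphaUV : A⟦X⟧⟦X⟧ := PowerSeries.X - PowerSeries.C PowerSeries.X

variable (A) in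
/-- The element `u⁻¹ v⁻¹`. -/
noncomputable def betaUV : A⟦X⟧⟦X⟧ := PowerSeries.X * PowerSeries.C PowerSeries.X

theorem C_X_comm (G : A⟦X⟧⟦X⟧) :
    PowerSeries.C PowerSeries.X * G = G * PowerSeries.C PowerSeries.X := by
  ext s : 1
  simp [PowerSeries.coeff_C_mul, PowerSeries.coeff_mul_C, (PowerSeries.commute_X _).eq]

theorem alphaUV_comm (G : A⟦X⟧⟦X⟧) : alphaUV A * G = G * alphaUV A := by
  rw [alphaUV, sub_mul, mul_sub, C_X_comm, (PowerSeries.commute_X G).eq]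

theorem betaUV_comm (G : A⟦X⟧⟦X⟧) : betaUV A * G = G * betaUV A := by
  rw [betaUV, mul_assoc, C_X_comm, ← mul_assoc, ← (PowerSeries.commute_X G).eq, mul_assoc]

/-- This encodes (u − v) G = H after multiplication by u⁻¹v⁻¹. The two boundary conditions say that
(u − v) G has no terms with a positive power of u or v. -/
theorem alphaUV_mul_eq_iff (G H : A⟦X⟧⟦X⟧) :
    alphaUV A * G = betaUV A * H ↔
      (∀ r, coeffUV r 0 G = 0) ∧ (∀ s, coeffUV 0 s G = 0) ∧
        ∀ r s, coeffUV (r + 1) s G - coeffUV r (s + 1) G = coeffUV r s H := by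
  have e1 : ∀ r s, coeffUV (r + 1) (s + 1) (alphaUV A * G) =
      coeffUV (r + 1) s G - coeffUV r (s + 1) G := fun r s => by
    simp [coeffUV_apply, alphaUV, sub_mul, PowerSeries.coeff_succ_X_mul]
  have e2 : ∀ r s, coeffUV (r + 1) (s + 1) (betaUV A * H) = coeffUV r s H := fun r s => by
    simp [coeffUV_apply, betaUV, mul_assoc, PowerSeries.coeff_succ_X_mul]
  have e3 : ∀ r, coeffUV (r + 1) 0 (alphaUV A * G) = -coeffUV r 0 G := fun r => by
    simp only [coeffUV_apply, alphaUV, sub_mul, map_sub, PowerSeries.coeff_zero_X_mul,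
      PowerSeries.coeff_C_mul, PowerSeries.coeff_succ_X_mul, map_zero, zero_sub]
  have e4 : ∀ s, coeffUV 0 (s + 1) (alphaUV A * G) = coeffUV 0 s G := fun s => by
    simp [coeffUV_apply, alphaUV, sub_mul, PowerSeries.coeff_succ_X_mul]
  have e5 : coeffUV 0 0 (alphaUV A * G) = 0 := by
    simp [coeffUV_apply, alphaUV, sub_mul]
  have e6 : ∀ r, coeffUV r 0 (betaUV A * H) = 0 := fun r => by
    simp [coeffUV_apply, betaUV, mul_assoc]
  have e7 : ∀ s, coeffUV 0 s (betaUV A * H) = 0 := fun s => by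
    cases s with
    | zero => exact e6 0
    | succ s => simp [coeffUV_apply, betaUV, mul_assoc, PowerSeries.coeff_succ_X_mul]
  constructor
  · intro h
    refine ⟨fun r => ?_, fun s => ?_, fun r s => ?_⟩
    · rw [← neg_eq_zero, ← e3, h, e6]
    · rw [← e4, h, e7]
    · rw [← e1, h, e2]
  · rintro ⟨h1, h2, h3⟩
    refine coeffUV_ext fun r s => ?_
    rcases r with _ | r <;> rcases s with _ | s
    · rw [e5, e6]
    · rw [e4, e7, h2]
    · rw [e3, e6, h1, neg_zero]
    · rw [e1, e2, h3]

/-- The factor u − v can be cancelled: the coefficients vanish by induction on the degree in v⁻¹. -/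
theorem eq_zero_of_alphaUV_mul {G : A⟦X⟧⟦X⟧} (h : alphaUV A * G = 0) : G = 0 := by
  obtain ⟨h1, -, h3⟩ := (alphaUV_mul_eq_iff G 0).mp (by rw [h, mul_zero])
  have key : ∀ s r, coeffUV r s G = 0 := by
    intro s
    induction s with
    | zero => exact h1
    | succ s ih =>
      intro r
      have := h3 r s
      rw [ih, map_zero, zero_sub, neg_eq_zero] at this
      exact this
  exact coeffUV_ext fun r s => by rw [key, map_zero]

theorem commute_inU_inV_iff (f g : A⟦X⟧) :
    Commute (inU f) (inV g) ↔
      ∀ r s, Commute (PowerSeries.coeff r f) (PowerSeries.coeff s g) := by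
  refine ⟨fun h r s => ?_, fun h => coeffUV_ext fun r s => ?_⟩
  · have := congrArg (coeffUV r s) h.eq
    rwa [coeffUV_inU_mul_inV, coeffUV_inV_mul_inU] at this
  · rw [coeffUV_inU_mul_inV, coeffUV_inV_mul_inU, (h r s).eq]

/-- The restriction of a series in `u⁻¹`, `v⁻¹` to the diagonal `u = v`. -/
noncomputable def diagUV : A⟦X⟧⟦X⟧ →+ A⟦X⟧ where
  toFun G := PowerSeries.mk fun N =>
    ∑ x ∈ Finset.HasAntidiagonal.antidiagonal N, coeffUV x.1 x.2 G
  map_zero' := by ext; simp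
  map_add' G H := by ext; simp [Finset.sum_add_distrib]

theorem coeff_diagUV (G : A⟦X⟧⟦X⟧) (N : ℕ) : PowerSeries.coeff N (diagUV G) =
    ∑ x ∈ Finset.HasAntidiagonal.antidiagonal N, coeffUV x.1 x.2 G := by
  simp [diagUV]

@[simp] theorem diagUV_inU_mul_inV (f g : A⟦X⟧) : diagUV (inU f * inV g) = f * g := by
  ext N
  simp [coeff_diagUV, PowerSeries.coeff_mul]

@[simp] theorem diagUV_inV_mul_inU (f g : A⟦X⟧) : diagUV (inV g * inU f) = g * f := by
  ext N
  simp only [coeff_diagUV, PowerSeries.coeff_mul, coeffUV_inV_mul_inU]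
  exact Finset.Nat.sum_antidiagonal_swap
    (f := fun x => PowerSeries.coeff x.1 g * PowerSeries.coeff x.2 f)

theorem diagUV_X_mul (G : A⟦X⟧⟦X⟧) : diagUV (PowerSeries.X * G) = PowerSeries.X * diagUV G := by
  ext N
  cases N with
  | zero => simp [coeff_diagUV, coeffUV_apply]
  | succ N =>
    rw [PowerSeries.coeff_succ_X_mul, coeff_diagUV, coeff_diagUV,
      Finset.Nat.sum_antidiagonal_succ']
    simp [coeffUV_apply, PowerSeries.coeff_succ_X_mul]

theorem diagUV_C_X_mul (G : A⟦X⟧⟦X⟧) :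
    diagUV (PowerSeries.C PowerSeries.X * G) = PowerSeries.X * diagUV G := by
  ext N
  cases N with
  | zero => simp [coeff_diagUV, coeffUV_apply]
  | succ N =>
    rw [PowerSeries.coeff_succ_X_mul, coeff_diagUV, coeff_diagUV,
      Finset.Nat.sum_antidiagonal_succ]
    simp [coeffUV_apply, PowerSeries.coeff_succ_X_mul]

end TwoVariables

/-! ### Inverse matrices and their commutators -/

section Inverse

variable {R : Type*} [Ring R] {ι : Type*} [Fintype ι] [DecidableEq ι]

/-- Multiply the relation by w on both sides and use w (t x − x t) w = x w − w x; α and β pass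
through because they are central. -/
theorem commutator_inverse {α β : R} (hα : ∀ x, α * x = x * α) (hβ : ∀ x, β * x = x * β)
    {t w : Matrix ι ι R} (hwt : w * t = 1) (htw : t * w = 1) {x : R} {Y Z Y' Z' : Matrix ι ι R}
    {p q p' q' : ι}
    (h : ∀ i j, α * (t i j * x - x * t i j) = β * (Y i p * Z q j - Y' i p' * Z' q' j)) (a b : ι) :
    α * (x * w a b - w a b * x) =
      β * ((w * Y) a p * (Z * w) q b - (w * Y') a p' * (Z' * w) q' b) := by
  have e1 : ∑ j, ∑ i, w a i * (t i j * x) * w j b = x * w a b := by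
    calc _ = ∑ j, (w * t) a j * (x * w j b) := by
          simp only [Matrix.mul_apply, Finset.sum_mul, mul_assoc]
      _ = x * w a b := by simp [hwt, Matrix.one_apply]
  have e2 : ∑ j, ∑ i, w a i * (x * t i j) * w j b = w a b * x := by
    calc _ = ∑ i, w a i * x * (t * w) i b := by
          rw [Finset.sum_comm]
          simp only [Matrix.mul_apply, Finset.mul_sum, mul_assoc]
      _ = w a b * x := by simp [htw, Matrix.one_apply]
  have e3 : ∀ (Y Z : Matrix ι ι R) (p q : ι),
      ∑ j, ∑ i, w a i * (Y i p * Z q j) * w j b = (w * Y) a p * (Z * w) q b := by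
    intro Y Z p q
    rw [Matrix.mul_apply, Matrix.mul_apply, Finset.sum_mul_sum, Finset.sum_comm]
    simp only [mul_assoc]
  have e4 : ∀ (γ : R), (∀ x, γ * x = x * γ) → ∀ F : ι → ι → R,
      γ * ∑ j, ∑ i, w a i * F i j * w j b = ∑ j, ∑ i, w a i * (γ * F i j) * w j b := by
    intro γ hγ F
    simp only [Finset.mul_sum]
    refine Finset.sum_congr rfl fun j _ => Finset.sum_congr rfl fun i _ => ?_
    rw [← mul_assoc, ← mul_assoc, hγ (w a i), mul_assoc (w a i)]
  rw [← e1, ← e2, ← e3, ← e3]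
  simp only [← Finset.sum_sub_distrib, ← sub_mul, ← mul_sub]
  rw [e4 α hα, e4 β hβ]
  simp only [h]

theorem commute_inverse {t w : Matrix ι ι R} (hwt : w * t = 1) (htw : t * w = 1) {x : R}
    (h : ∀ i j, Commute x (t i j)) (a b : ι) : Commute x (w a b) := by
  have := commutator_inverse (α := (1 : R)) (β := 0) (by simp) (by simp) hwt htw
    (x := x) (Y := 0) (Z := 0) (Y' := 0) (Z' := 0) (p := a) (q := a) (p' := a) (q' := a)
    (fun i j => by rw [(h i j).eq]; simp) a b
  rw [one_mul, zero_mul, sub_eq_zero] at this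
  exact this

variable {A : Type*} [Ring A]

/-- Matrices of series are series of matrices, and a series with constant term 1 is invertible over
any ring. -/
theorem exists_inverse_of_constantCoeff (M : Matrix ι ι A⟦X⟧)
    (hM : M.map PowerSeries.constantCoeff = 1) :
    ∃ W : Matrix ι ι A⟦X⟧, W * M = 1 ∧ M * W = 1 := by
  let F : Matrix ι ι A⟦X⟧ → PowerSeries (Matrix ι ι A) := fun N =>
    PowerSeries.mk fun r => N.map (PowerSeries.coeff r)
  have hFinj : Function.Injective F := by
    intro N N' h
    ext i j r
    have := congrArg (fun G : PowerSeries (Matrix ι ι A) =>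
      (PowerSeries.coeff r G : Matrix ι ι A) i j) h
    simpa [F] using this
  have hFsurj : ∀ G : PowerSeries (Matrix ι ι A), ∃ N, F N = G := by
    intro G
    refine ⟨Matrix.of fun i j => PowerSeries.mk fun r =>
      (PowerSeries.coeff r G : Matrix ι ι A) i j, ?_⟩
    ext r i j
    simp [F]
  have hFmul : ∀ N N', F (N * N') = F N * F N' := by
    intro N N'
    ext r i j
    simp only [F, PowerSeries.coeff_mk, Matrix.map_apply, Matrix.mul_apply, map_sum,
      PowerSeries.coeff_mul, Matrix.sum_apply]
    rw [Finset.sum_comm]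
  have hFone : F 1 = 1 := by
    ext r i j
    by_cases hr : r = 0 <;> by_cases hij : i = j <;>
      simp [F, PowerSeries.coeff_one, hr, hij]
  have hc : PowerSeries.constantCoeff (F M) = ((1 : (Matrix ι ι A)ˣ) : Matrix ι ι A) := by
    rw [Units.val_one, ← hM, ← PowerSeries.coeff_zero_eq_constantCoeff_apply]
    ext i j
    simp [F]
  obtain ⟨W, hW⟩ := hFsurj (PowerSeries.invOfUnit (F M) 1)
  refine ⟨W, hFinj ?_, hFinj ?_⟩
  · rw [hFmul, hW, hFone, PowerSeries.invOfUnit_mul _ _ hc]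
  · rw [hFmul, hW, hFone, PowerSeries.mul_invOfUnit _ _ hc]

end Inverse

/-! ### The Yangian relation for a matrix of series -/

section RTT

variable {A : Type*} [Ring A] {ι κ : Type*}

/-- The defining relation
`(u - v) [m_{ij}(u), m_{kl}(v)] = m_{kj}(u) m_{il}(v) - m_{kj}(v) m_{il}(u)` of the Yangian, for the entries of a matrix. -/
def IsRTT (M : Matrix ι κ A⟦X⟧) : Prop :=
  ∀ i j k l, alphaUV A * (inU (M i j) * inV (M k l) - inV (M k l) * inU (M i j)) =
    betaUV A * (inU (M k j) * inV (M i l) - inV (M k j) * inU (M i l))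

theorem IsRTT.submatrix {ι' κ' : Type*} {M : Matrix ι κ A⟦X⟧} (hM : IsRTT M) (f : ι' → ι)
    (g : κ' → κ) : IsRTT (M.submatrix f g) :=
  fun _ _ _ _ => hM _ _ _ _

theorem isRTT_iff_coeff {M : Matrix ι κ A⟦X⟧} :
    IsRTT M ↔ ∀ i j k l,
      (∀ r, Commute (PowerSeries.coeff r (M i j)) (PowerSeries.coeff 0 (M k l))) ∧
      (∀ r, Commute (PowerSeries.coeff 0 (M i j)) (PowerSeries.coeff r (M k l))) ∧
      ∀ r s, ⁅PowerSeries.coeff (r + 1) (M i j), PowerSeries.coeff s (M k l)⁆ -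
          ⁅PowerSeries.coeff r (M i j), PowerSeries.coeff (s + 1) (M k l)⁆ =
        PowerSeries.coeff r (M k j) * PowerSeries.coeff s (M i l) -
          PowerSeries.coeff s (M k j) * PowerSeries.coeff r (M i l) := by
  simp only [IsRTT, alphaUV_mul_eq_iff, map_sub, coeffUV_inU_mul_inV, coeffUV_inV_mul_inU,
    sub_eq_zero, Ring.lie_def]
  rfl

/-- Exchanging (i, j, u) with (k, l, v) preserves the left-hand side and reverses the order of the
factors on the right. -/
theorem isRTT_iff_symm {M : Matrix ι κ A⟦X⟧} :
    IsRTT M ↔ ∀ i j k l,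
      alphaUV A * (inU (M i j) * inV (M k l) - inV (M k l) * inU (M i j)) =
        betaUV A * (inV (M i l) * inU (M k j) - inU (M i l) * inV (M k j)) := by
  rw [isRTT_iff_coeff]
  simp only [alphaUV_mul_eq_iff, map_sub, coeffUV_inU_mul_inV, coeffUV_inV_mul_inU,
    sub_eq_zero]
  constructor
  · intro h i j k l
    refine ⟨(h i j k l).1, (h i j k l).2.1, fun r s => ?_⟩
    rw [← (h k l i j).2.2 s r, Ring.lie_def, Ring.lie_def]
    abel
  · intro h i j k l
    refine ⟨(h i j k l).1, (h i j k l).2.1, fun r s => ?_⟩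
    rw [← (h k l i j).2.2 s r, Ring.lie_def, Ring.lie_def]
    abel

section Shift

variable [Algebra ℂ A]

theorem one_sub_smul_mul_shift_X (a : ℂ) :
    (1 - a • PowerSeries.X) * shift a (PowerSeries.X : A⟦X⟧) = PowerSeries.X := by
  have h : (a • PowerSeries.X : A⟦X⟧) = PowerSeries.C (algebraMap ℂ A a) * PowerSeries.X := by
    rw [Algebra.smul_def, PowerSeries.algebraMap_apply]
  rw [h, one_sub_mul_shift_X]

variable (A) in
/-- The constant series as an algebra homomorphism. -/
noncomputable def constHom : A →ₐ[ℂ] A⟦X⟧ :=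
  { (PowerSeries.C : A →+* A⟦X⟧) with
    commutes' := fun _ => (PowerSeries.algebraMap_apply).symm }

theorem shift_inU (a : ℂ) (f : A⟦X⟧) : shift a (inU f) = inU f := shift_C a f

theorem shift_inV (a : ℂ) (f : A⟦X⟧) : shift a (inV f) = inV (shift a f) :=
  shift_map a (constHom A) f

/-- The difference u − v is invariant under shifting both variables by a. In terms of u⁻¹ and v⁻¹
this appears after clearing the denominators 1 − a u⁻¹ and 1 − a v⁻¹. -/
theorem IsRTT.shift {M : Matrix ι κ A⟦X⟧} (hM : IsRTT M) (a : ℂ) :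
    IsRTT (M.map (shift a)) := by
  let Θ : A⟦X⟧⟦X⟧ →+* A⟦X⟧⟦X⟧ := (shiftHom A⟦X⟧ a).toRingHom.comp
    (PowerSeries.map (shiftHom A a).toRingHom)
  have hU : ∀ f, Θ (inU f) = inU (Yangian.shift a f) := fun f => by
    simp [Θ, inU, shift_C]
  have hV : ∀ f, Θ (inV f) = inV (Yangian.shift a f) := fun f => by
    rw [← shift_inV]
    have h : PowerSeries.map (shiftHom A a).toRingHom (inV f) = inV f := by
      ext1 s
      simp [inV, shift_C]
    exact congrArg (Yangian.shift a) h
  have hY : Θ PowerSeries.X = Yangian.shift a PowerSeries.X := by simp [Θ]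
  have hX : Θ (PowerSeries.C PowerSeries.X) = PowerSeries.C (Yangian.shift a PowerSeries.X) :=
    hU _
  have pY := one_sub_smul_mul_shift_X (A := A⟦X⟧) a
  have pX := congrArg (PowerSeries.C (R := A⟦X⟧)) (one_sub_smul_mul_shift_X (A := A) a)
  have hs : PowerSeries.C (a • PowerSeries.X : A⟦X⟧) = a • PowerSeries.C (PowerSeries.X : A⟦X⟧) := by
    exact map_smul (constHom A⟦X⟧) a _
  rw [map_mul, map_sub, map_one, hs] at pX
  have hXY : (PowerSeries.C PowerSeries.X : A⟦X⟧⟦X⟧) * PowerSeries.X =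
    PowerSeries.X * PowerSeries.C PowerSeries.X := C_X_comm _
  intro i j k l
  have h := congrArg Θ (hM i j k l)
  simp only [map_mul, map_sub, hU, hV, alphaUV, betaUV, hX, hY] at h
  simp only [Matrix.map_apply]
  set y : A⟦X⟧⟦X⟧ := Yangian.shift a PowerSeries.X
  set x : A⟦X⟧⟦X⟧ := PowerSeries.C (Yangian.shift a PowerSeries.X)
  have hcomm : (1 - a • PowerSeries.C (PowerSeries.X : A⟦X⟧)) * (1 - a • PowerSeries.X) =
      (1 - a • (PowerSeries.X : A⟦X⟧⟦X⟧)) * (1 - a • PowerSeries.C (PowerSeries.X : A⟦X⟧)) := by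
    simp only [sub_mul, mul_sub, one_mul, mul_one, smul_mul_smul_comm, hXY]
    abel
  have c1 : (1 - a • PowerSeries.C (PowerSeries.X : A⟦X⟧)) * ((1 - a • PowerSeries.X) * (y - x)) =
      alphaUV A := by
    rw [mul_sub, mul_sub, pY, ← mul_assoc, hcomm, mul_assoc, pX, alphaUV]
    simp only [sub_mul, one_mul, smul_mul_assoc, hXY]
    abel
  have c2 : (1 - a • PowerSeries.C (PowerSeries.X : A⟦X⟧)) * ((1 - a • PowerSeries.X) * (y * x)) =
      betaUV A := by
    rw [← mul_assoc (1 - a • PowerSeries.X), pY, ← (PowerSeries.commute_X x).eq, ← mul_assoc, pX,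
      hXY, betaUV]
  have h3 := congrArg (fun z => (1 - a • PowerSeries.C (PowerSeries.X : A⟦X⟧)) *
    ((1 - a • (PowerSeries.X : A⟦X⟧⟦X⟧)) * z)) h
  beta_reduce at h3
  rw [← mul_assoc (1 - a • PowerSeries.X), ← mul_assoc (1 - a • PowerSeries.C _), c1,
    ← mul_assoc (1 - a • PowerSeries.X), ← mul_assoc (1 - a • PowerSeries.C _), c2] at h3
  exact h3

/-- Here v has been replaced by v − 1, so on the diagonal v = u the factor u − v has become 1. -/
theorem diagUV_eq_of_shift_one {G H : A⟦X⟧⟦X⟧}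
    (h : (shift 1 PowerSeries.X - PowerSeries.C PowerSeries.X) * G =
      shift 1 PowerSeries.X * PowerSeries.C PowerSeries.X * H) : diagUV G = diagUV H := by
  have pY := one_sub_smul_mul_shift_X (A := A⟦X⟧) 1
  have h2 := congrArg (fun z => diagUV ((1 - (1 : ℂ) • (PowerSeries.X : A⟦X⟧⟦X⟧)) * z)) h
  beta_reduce at h2
  rw [← mul_assoc, mul_sub, pY, ← mul_assoc, ← mul_assoc, pY, mul_assoc PowerSeries.X] at h2
  simp only [sub_mul, one_mul, one_smul, map_sub, mul_assoc, diagUV_X_mul, diagUV_C_X_mul,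
    sub_sub_cancel] at h2
  have hX : ∀ z z' : A⟦X⟧, PowerSeries.X * z = PowerSeries.X * z' → z = z' := by
    intro z z' hz
    ext r
    rw [← PowerSeries.coeff_succ_X_mul, hz, PowerSeries.coeff_succ_X_mul]
  exact hX _ _ (hX _ _ h2)

theorem IsRTT.mul_shift_one_sub {M : Matrix ι κ A⟦X⟧} (hM : IsRTT M) (i : ι) (j : κ) (k : ι)
    (l : κ) :
    M i j * Yangian.shift 1 (M k l) - M k j * Yangian.shift 1 (M i l) =
      Yangian.shift 1 (M k l) * M i j - Yangian.shift 1 (M k j) * M i l := by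
  have h := congrArg (shiftHom A⟦X⟧ 1) (hM i j k l)
  simp only [map_mul, map_sub, shiftHom_apply, shift_inU, shift_inV, alphaUV, betaUV] at h
  have hC : Yangian.shift 1 (PowerSeries.C (PowerSeries.X : A⟦X⟧)) = PowerSeries.C PowerSeries.X :=
    shift_C _ _
  rw [hC] at h
  have h2 := diagUV_eq_of_shift_one h
  simp only [map_sub, diagUV_inU_mul_inV, diagUV_inV_mul_inU] at h2
  rw [sub_eq_sub_iff_add_eq_add] at h2 ⊢
  rw [add_comm, ← sub_eq_iff_eq_add'] at h2
  rw [← h2]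
  abel

/-- The right-hand side of `IsRTT.mul_shift_one_sub` changes sign when the two column indices are
exchanged. -/
theorem IsRTT.isSkewManin {M : Matrix ι κ A⟦X⟧} (hM : IsRTT M) :
    IsSkewManin (shiftHom A 1) M := by
  intro i k j l
  simp only [shiftHom_apply]
  rw [hM.mul_shift_one_sub i j k l, hM.mul_shift_one_sub i l k j, neg_sub]

theorem IsRTT.isSkewManin_op {M : Matrix ι κ A⟦X⟧} (hM : IsRTT M) :
    IsSkewManin (AlgHom.op (shiftHom A 1)) (opTranspose M) := by
  intro i k j l
  apply MulOpposite.unop_injective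
  simp only [opTranspose, Matrix.of_apply, AlgHom.op_apply_apply, MulOpposite.unop_op,
    MulOpposite.unop_sub, MulOpposite.unop_mul, MulOpposite.unop_neg,
    shiftHom_apply]
  rw [← hM.mul_shift_one_sub j i l k, ← hM.mul_shift_one_sub l i j k, neg_sub]

end Shift

end RTT

/-! ### Inverses and Schur complements of solutions of the Yangian relation -/

section SchurComplement

variable {A : Type*} [Ring A] {ι κ : Type*} [Fintype ι] [DecidableEq ι] [Fintype κ] [DecidableEq κ]

theorem map_mul_map_eq_one {R R' : Type*} [Ring R] [Ring R'] (f : R →+* R') {M W : Matrix ι ι R}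
    (h : W * M = 1) : W.map f * M.map f = 1 := by
  rw [← Matrix.map_mul, h, Matrix.map_one _ f.map_zero f.map_one]

theorem IsRTT.commutator_inverse {M W : Matrix ι ι A⟦X⟧} (hM : IsRTT M) (hWM : W * M = 1)
    (hMW : M * W = 1) (k l a b : ι) :
    alphaUV A * (inV (M k l) * inU (W a b) - inU (W a b) * inV (M k l)) =
      betaUV A * ((W.map inU * M.map inV) a l * (1 : Matrix ι ι A⟦X⟧⟦X⟧) k b -
        (1 : Matrix ι ι A⟦X⟧⟦X⟧) a l * (M.map inV * W.map inU) k b) := by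
  have h := Yangian.commutator_inverse alphaUV_comm betaUV_comm (map_mul_map_eq_one inU hWM)
    (map_mul_map_eq_one inU hMW) (x := inV (M k l)) (Y := M.map inV) (Z := M.map inU)
    (Y' := M.map inU) (Z' := M.map inV) (p := l) (q := k) (p' := l) (q' := k)
    (fun i j => isRTT_iff_symm.mp hM i j k l) a b
  rwa [map_mul_map_eq_one inU hWM, map_mul_map_eq_one inU hMW] at h

/-- The previous lemma inverts M in the variable u; inverting in v as well leaves the Yangian
relation with its right-hand side negated, that is, with u, v replaced by −u, −v. -/
theorem IsRTT.inverse {M W : Matrix ι ι A⟦X⟧} (hM : IsRTT M) (hWM : W * M = 1)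
    (hMW : M * W = 1) (a b c d : ι) :
    alphaUV A * (inU (W a b) * inV (W c d) - inV (W c d) * inU (W a b)) =
      betaUV A * (inV (W c b) * inU (W a d) - inU (W c b) * inV (W a d)) := by
  have hV := map_mul_map_eq_one inV hMW
  have hV' := map_mul_map_eq_one inV hWM
  have h := Yangian.commutator_inverse alphaUV_comm betaUV_comm hV' hV (x := inU (W a b))
    (Y := 1) (Z := W.map inU * M.map inV) (Y' := M.map inV * W.map inU) (Z' := 1) (p := b) (q := a)
    (p' := b) (q' := a) (fun k l => by
      rw [Matrix.map_apply, hM.commutator_inverse hWM hMW k l a b]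
      congr 2
      · simp only [Matrix.one_apply]; split_ifs <;> simp
      · simp only [Matrix.one_apply]; split_ifs <;> simp) c d
  rw [mul_one, Matrix.mul_assoc, hV, mul_one, ← Matrix.mul_assoc, hV', one_mul, one_mul] at h
  exact h

/-- The converse passage: two more inversions, first in v (`step`), then in u, restore the original
sign. -/
theorem isRTT_of_inverse {W S : Matrix ι ι A⟦X⟧}
    (hW : ∀ a b c d, alphaUV A * (inU (W a b) * inV (W c d) - inV (W c d) * inU (W a b)) =
      betaUV A * (inV (W c b) * inU (W a d) - inU (W c b) * inV (W a d)))
    (hSW : S * W = 1) (hWS : W * S = 1) : IsRTT S := by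
  have hU := map_mul_map_eq_one inU hSW
  have hU' := map_mul_map_eq_one inU hWS
  have hV := map_mul_map_eq_one inV hSW
  have hV' := map_mul_map_eq_one inV hWS
  have step : ∀ a b e f, alphaUV A * (inU (W a b) * inV (S e f) - inV (S e f) * inU (W a b)) =
      betaUV A * ((S.map inV * W.map inU) e b * (1 : Matrix ι ι A⟦X⟧⟦X⟧) a f -
        (1 : Matrix ι ι A⟦X⟧⟦X⟧) e b * (W.map inU * S.map inV) a f) := by
    intro a b e f
    have h := Yangian.commutator_inverse alphaUV_comm betaUV_comm hV hV' (x := inU (W a b))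
      (Y := W.map inU) (Z := W.map inV) (Y' := W.map inV) (Z' := W.map inU) (p := b) (q := a)
      (p' := b) (q' := a) (fun c d => by
        have h1 := hW a b c d
        rw [← neg_sub, mul_neg, neg_eq_iff_eq_neg, ← mul_neg, neg_sub] at h1
        exact h1) e f
    rw [hV, hV'] at h
    exact h
  rw [isRTT_iff_symm]
  intro g h e f
  have h1 := Yangian.commutator_inverse alphaUV_comm betaUV_comm hU hU' (x := inV (S e f))
    (Y := 1) (Z := S.map inV * W.map inU) (Y' := W.map inU * S.map inV) (Z' := 1) (p := f) (q := e)
    (p' := f) (q' := e) (fun a b => by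
      rw [Matrix.map_apply, step a b e f]
      congr 2
      · simp only [Matrix.one_apply]; split_ifs <;> simp
      · simp only [Matrix.one_apply]; split_ifs <;> simp) g h
  rw [mul_one, Matrix.mul_assoc, hU', mul_one, ← Matrix.mul_assoc, hU, one_mul, one_mul] at h1
  rw [← neg_sub, mul_neg, neg_eq_iff_eq_neg, ← mul_neg, neg_sub] at h1
  exact h1

theorem IsRTT.exists_schurComplement {M : Matrix (ι ⊕ κ) (ι ⊕ κ) A⟦X⟧} (hM : IsRTT M)
    (h1 : M.map PowerSeries.constantCoeff = 1) :
    ∃ (s : Matrix ι ι A⟦X⟧) (x : Matrix κ ι A⟦X⟧) (y : Matrix ι κ A⟦X⟧),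
      M.toBlocks₂₁ = M.toBlocks₂₂ * x ∧ M.toBlocks₁₂ = y * M.toBlocks₂₂ ∧
      s = M.toBlocks₁₁ - M.toBlocks₁₂ * x ∧ s = M.toBlocks₁₁ - y * M.toBlocks₂₁ ∧
      IsRTT s ∧ s.map PowerSeries.constantCoeff = 1 ∧
      ∀ i j k l, ∀ r q, Commute (PowerSeries.coeff r (M.toBlocks₂₂ k l))
        (PowerSeries.coeff q (s i j)) := by
  obtain ⟨W, hWM, hMW⟩ := exists_inverse_of_constantCoeff M h1
  have h1d : M.toBlocks₂₂.map PowerSeries.constantCoeff = 1 := by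
    ext i j
    have := congrFun (congrFun h1 (Sum.inr i)) (Sum.inr j)
    simpa [Matrix.toBlocks₂₂, Matrix.one_apply] using this
  obtain ⟨K, hKd, hdK⟩ := exists_inverse_of_constantCoeff _ h1d
  set s := M.toBlocks₁₁ - M.toBlocks₁₂ * K * M.toBlocks₂₁ with hs
  have b1 := hWM
  have b2 := hMW
  rw [← Matrix.fromBlocks_toBlocks M, ← Matrix.fromBlocks_toBlocks W, Matrix.fromBlocks_multiply,
    ← Matrix.fromBlocks_one, Matrix.fromBlocks_inj] at b1 b2
  obtain ⟨b11, b12, -, -⟩ := b1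
  obtain ⟨b21, -, b23, -⟩ := b2
  -- The Schur complement is the inverse of the corner block of M⁻¹. That corner inherits the
  -- relation for inverses, so its inverse s satisfies the Yangian relation.
  have hsw : s * W.toBlocks₁₁ = 1 := by
    have : W.toBlocks₂₁ = -(K * (M.toBlocks₂₁ * W.toBlocks₁₁)) := by
      rw [← add_eq_zero_iff_eq_neg, ← Matrix.one_mul W.toBlocks₂₁, ← hKd, Matrix.mul_assoc,
        ← Matrix.mul_add, add_comm, b23, Matrix.mul_zero]
    rw [← b21, this, hs, Matrix.sub_mul, Matrix.mul_neg, ← sub_eq_add_neg]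
    simp only [Matrix.mul_assoc]
  have hws : W.toBlocks₁₁ * s = 1 := by
    have : W.toBlocks₁₂ = -(W.toBlocks₁₁ * M.toBlocks₁₂ * K) := by
      rw [← add_eq_zero_iff_eq_neg, ← Matrix.mul_one W.toBlocks₁₂, ← hdK, ← Matrix.mul_assoc,
        ← Matrix.add_mul, add_comm, b12, Matrix.zero_mul]
    rw [← b11, this, hs, Matrix.mul_sub, Matrix.neg_mul, ← sub_eq_add_neg]
    simp only [Matrix.mul_assoc]
  refine ⟨s, K * M.toBlocks₂₁, M.toBlocks₁₂ * K, ?_, ?_, ?_, rfl, ?_, ?_, ?_⟩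
  · rw [← Matrix.mul_assoc, hdK, Matrix.one_mul]
  · rw [Matrix.mul_assoc, hKd, Matrix.mul_one]
  · rw [hs, Matrix.mul_assoc]
  · exact isRTT_of_inverse (W := W.toBlocks₁₁)
      (fun a b c d => hM.inverse hWM hMW (Sum.inl a) (Sum.inl b) (Sum.inl c) (Sum.inl d)) hsw hws
  · have h11 : M.toBlocks₁₁.map PowerSeries.constantCoeff = 1 := by
      ext i j
      have := congrFun (congrFun h1 (Sum.inl i)) (Sum.inl j)
      simpa [Matrix.toBlocks₁₁, Matrix.one_apply] using this
    have h21 : M.toBlocks₂₁.map PowerSeries.constantCoeff = 0 := by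
      ext i j
      have := congrFun (congrFun h1 (Sum.inr i)) (Sum.inl j)
      simpa [Matrix.toBlocks₂₁, Matrix.one_apply] using this
    rw [hs, Matrix.map_sub _ (map_sub _), Matrix.map_mul, h11, h21, Matrix.mul_zero, sub_zero]
  · intro k l i j r q
    refine (((commute_inU_inV_iff _ _).mp ?_) q r).symm
    have hU := map_mul_map_eq_one (f := inU) hsw
    have hU' := map_mul_map_eq_one (f := inU) hws
    refine (commute_inverse hU hU' (x := inV (M.toBlocks₂₂ i j)) (fun a b => ?_) k l).symm
    -- With indices in different blocks both Kronecker deltas vanish, so the commutator is killed by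
    -- u − v and is therefore zero.
    have h := hM.commutator_inverse hWM hMW (Sum.inr i) (Sum.inr j) (Sum.inl a) (Sum.inl b)
    rw [Matrix.one_apply_ne (by simp), Matrix.one_apply_ne (by simp), mul_zero, zero_mul, sub_zero,
      mul_zero] at h
    exact sub_eq_zero.mp (eq_zero_of_alphaUV_mul h)

/-- The factor u − v − 1 can be cancelled. -/
theorem eq_zero_of_alphaUV_mul_eq_betaUV_mul {G : A⟦X⟧⟦X⟧} (h : alphaUV A * G = betaUV A * G) :
    G = 0 := by
  obtain ⟨h1, -, h3⟩ := (alphaUV_mul_eq_iff G G).mp h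
  have key : ∀ s r, coeffUV r s G = 0 := by
    intro s
    induction s with
    | zero => exact h1
    | succ s ih =>
      intro r
      have := h3 r s
      rw [ih, ih, zero_sub, neg_eq_zero] at this
      exact this
  exact coeffUV_ext fun r s => by rw [key, map_zero]

end SchurComplement

/-! ### Coefficientwise commuting series -/

section CoeffCommute

variable {A : Type*} [Ring A]

/-- All the coefficients of the series `f` commute with all the coefficients of `g`. -/
def CoeffCommute (f g : A⟦X⟧) : Prop :=
  ∀ r s, Commute (PowerSeries.coeff r f) (PowerSeries.coeff s g)

theorem CoeffCommute.symm {f g : A⟦X⟧} (h : CoeffCommute f g) : CoeffCommute g f :=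
  fun r s => (h s r).symm

theorem CoeffCommute.commute_inU_inV {f g : A⟦X⟧} (h : CoeffCommute f g) :
    Commute (inU f) (inV g) :=
  (commute_inU_inV_iff f g).mpr h

theorem CoeffCommute.commute {f g : A⟦X⟧} (h : CoeffCommute f g) : Commute f g := by
  have := congrArg diagUV h.commute_inU_inV.eq
  rwa [diagUV_inU_mul_inV, diagUV_inV_mul_inU] at this

variable [Algebra ℂ A]

/-- The series whose coefficients commute with those of `g`. -/
def coeffCentralizer (g : A⟦X⟧) : Subalgebra ℂ A⟦X⟧ where
  carrier := {f | CoeffCommute f g}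
  mul_mem' {f f'} h h' r s := by
    rw [PowerSeries.coeff_mul]
    exact Commute.sum_left _ _ _ fun x _ => (h _ _).mul_left (h' _ _)
  add_mem' {f f'} h h' r s := by
    rw [map_add]
    exact (h _ _).add_left (h' _ _)
  algebraMap_mem' z r s := by
    rw [PowerSeries.algebraMap_apply, PowerSeries.coeff_C]
    split_ifs
    · exact Algebra.commute_algebraMap_left _ _
    · exact Commute.zero_left _

theorem shift_mem_coeffCentralizer (a : ℂ) {f g : A⟦X⟧} (h : f ∈ coeffCentralizer g) :
    shift a f ∈ coeffCentralizer g := by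
  intro r s
  rw [coeff_shift a f le_rfl]
  exact Commute.sum_left _ _ _ fun x _ => (h _ _).smul_left _

theorem skewProd_mem {P : Type*} [Ring P] [Algebra ℂ P] {τ : P →ₐ[ℂ] P} {U : Subalgebra ℂ P}
    (hU : ∀ x ∈ U, τ x ∈ U) {l : List P} (hl : ∀ x ∈ l, x ∈ U) : skewProd τ l ∈ U := by
  induction l with
  | nil => exact U.one_mem
  | cons x l ih =>
    rw [skewProd_cons]
    exact U.mul_mem (hl x (by simp)) (hU _ (ih fun y hy => hl y (by simp [hy])))

theorem skewMinor_mem {P ι κ : Type*} [Ring P] [Algebra ℂ P] {τ : P →ₐ[ℂ] P} {U : Subalgebra ℂ P}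
    (hU : ∀ x ∈ U, τ x ∈ U) {M : Matrix ι κ P} {k : ℕ} (c : Fin k → ι) (d : Fin k → κ)
    (hM : ∀ i j, M (c i) (d j) ∈ U) : skewMinor τ M c d ∈ U := by
  refine U.sum_mem fun σ _ => zsmul_mem (skewProd_mem hU fun x hx => ?_) _
  obtain ⟨a, rfl⟩ := (List.mem_ofFn' _ _).mp hx
  exact hM _ _

theorem CoeffCommute.shift_left {f g : A⟦X⟧} (a : ℂ) (h : CoeffCommute f g) :
    CoeffCommute (shift a f) g :=
  shift_mem_coeffCentralizer a h

theorem CoeffCommute.mul_left {f f' g : A⟦X⟧} (h : CoeffCommute f g) (h' : CoeffCommute f' g) :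
    CoeffCommute (f * f') g :=
  (coeffCentralizer g).mul_mem h h'

theorem CoeffCommute.skewMinor_left {ι κ : Type*} {M : Matrix ι κ A⟦X⟧} {k : ℕ} {c : Fin k → ι}
    {d : Fin k → κ} {g : A⟦X⟧} (h : ∀ i j, CoeffCommute (M (c i) (d j)) g) :
    CoeffCommute (skewMinor (shiftHom A 1) M c d) g :=
  skewMinor_mem (U := coeffCentralizer g) (fun _ hx => shift_mem_coeffCentralizer 1 hx) c d h

end CoeffCommute

/-! ### Factorization of minors and existence of the quantum determinant -/

section QuantumDeterminant

variable {A : Type*} [Ring A] [Algebra ℂ A]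

theorem skewMinor_one_by_one {P ι κ : Type*} [Ring P] [Algebra ℂ P] (τ : P →ₐ[ℂ] P)
    (M : Matrix ι κ P) (c : Fin 1 → ι) (d : Fin 1 → κ) : skewMinor τ M c d = M (c 0) (d 0) := by
  simp [skewMinor]

theorem append_castAdd_natAdd (k m : ℕ) :
    Fin.append (Fin.castAdd m) (Fin.natAdd k) = (id : Fin (k + m) → Fin (k + m)) := by
  ext a
  refine Fin.addCases (fun i => ?_) (fun i => ?_) a <;> simp

theorem map_submatrix_eq_one {R R' ι ι' : Type*} [Ring R] [Ring R'] [DecidableEq ι]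
    [DecidableEq ι'] {F : R → R'} {M : Matrix ι ι R} (h1 : M.map F = 1) {f : ι' → ι}
    (hf : Function.Injective f) : (M.submatrix f f).map F = 1 := by
  rw [← Matrix.submatrix_map, h1]
  ext i j
  simp [Matrix.one_apply, hf.eq_iff]

/-- The matrix `s(u)` such that the minors of `M(u)` containing the rows and columns `b` are the
products of the minor for `b` and the minors of `s(u - k)`. -/
theorem IsRTT.exists_skewMinor_append {ι : Type*} [DecidableEq ι] {M : Matrix ι ι A⟦X⟧}
    (hM : IsRTT M) (h1 : M.map PowerSeries.constantCoeff = 1) {k m : ℕ} (b : Fin k → ι)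
    (a : Fin m → ι) (hab : Function.Injective (Sum.elim a b)) :
    ∃ s : Matrix (Fin m) (Fin m) A⟦X⟧, IsRTT s ∧ s.map PowerSeries.constantCoeff = 1 ∧
      (∀ i j k l, CoeffCommute (M (b k) (b l)) (s i j)) ∧
      (∀ {p : ℕ} (c d : Fin p → Fin m),
        skewMinor (shiftHom A 1) M (Fin.append b (a ∘ c)) (Fin.append b (a ∘ d)) =
          skewMinor (shiftHom A 1) M b b * (shiftHom A 1 ^ k) (skewMinor (shiftHom A 1) s c d)) ∧
      ∀ {p : ℕ} (c d : Fin p → Fin m),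
        skewMinor (AlgHom.op (shiftHom A 1)) (opTranspose M) (Fin.append b (a ∘ c))
            (Fin.append b (a ∘ d)) =
          skewMinor (AlgHom.op (shiftHom A 1)) (opTranspose M) b b *
            (AlgHom.op (shiftHom A 1) ^ k)
              (skewMinor (AlgHom.op (shiftHom A 1)) (opTranspose s) c d) := by
  obtain ⟨s, x, y, hx, hy, hsx, hsy, hs, hs1, hcomm⟩ :=
    (hM.submatrix (Sum.elim a b) (Sum.elim a b)).exists_schurComplement
      (map_submatrix_eq_one h1 hab)
  refine ⟨s, hs, hs1, hcomm, fun c d => ?_, fun c d => ?_⟩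
  · rw [skewMinor_append hM.isSkewManin b (a ∘ c) (a ∘ d) (x.submatrix id d)
      (fun β j => congrFun (congrFun hx β) (d j)), hsx]
    rfl
  · rw [skewMinor_append hM.isSkewManin_op b (a ∘ c) (a ∘ d) ((opTranspose y).submatrix id d)
      (fun β j => by
        refine (congrArg MulOpposite.op (congrFun (congrFun hy (d j)) β)).trans ?_
        rw [Matrix.mul_apply, Finset.op_sum]
        rfl), hsy]
    refine congrArg (fun N : Matrix _ _ A⟦X⟧ᵐᵒᵖ =>
      skewMinor (AlgHom.op (shiftHom A 1)) (opTranspose M) b b *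
        (AlgHom.op (shiftHom A 1) ^ k) (skewMinor (AlgHom.op (shiftHom A 1)) N id id))
      (a₂ := (opTranspose _).submatrix c d) ?_
    ext1 i j
    change _ = MulOpposite.op _
    rw [Matrix.sub_apply, Matrix.mul_apply, MulOpposite.op_sub, Finset.op_sum]
    rfl

/-- Split off the last index: the column minor is D(u) s(u − k) and the row minor s(u − k) D(u),
where D is the minor of the first k indices and s is a 1 × 1 Schur complement whose coefficients
commute with those of D. -/
theorem IsRTT.qdet_induction {k : ℕ} {M : Matrix (Fin k) (Fin k) A⟦X⟧} (hM : IsRTT M)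
    (h1 : M.map PowerSeries.constantCoeff = 1) :
    skewMinor (AlgHom.op (shiftHom A 1)) (opTranspose M) id id =
        MulOpposite.op (skewMinor (shiftHom A 1) M id id) ∧
      CoeffCommute (skewMinor (shiftHom A 1) M id id) (skewMinor (shiftHom A 1) M id id) ∧
      PowerSeries.constantCoeff (skewMinor (shiftHom A 1) M id id) = 1 := by
  induction k with
  | zero =>
    refine ⟨by simp [skewMinor], ?_, by simp [skewMinor]⟩
    exact (coeffCentralizer _).sum_mem fun σ _ => by
      simp
  | succ k ih =>
    have hfi : Function.Injective (Sum.elim (Fin.natAdd k) (Fin.castAdd 1) :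
        Fin 1 ⊕ Fin k → Fin (k + 1)) := by
      rintro (a | a) (b | b) h <;> simp [Fin.ext_iff] at h ⊢ <;> omega
    obtain ⟨s, hs, hs1, hcomm, hcol, hrow⟩ := hM.exists_skewMinor_append h1 _ _ hfi
    obtain ⟨ih1, ih2, ih3⟩ := ih (hM.submatrix (Fin.castAdd 1) (Fin.castAdd 1))
      (map_submatrix_eq_one h1 (Fin.castAdd_injective k 1))
    set D := skewMinor (shiftHom A 1) (M.submatrix (Fin.castAdd 1) (Fin.castAdd 1)) id id with hD
    have hDs : ∀ i j, CoeffCommute D (s i j) := fun i j =>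
      CoeffCommute.skewMinor_left fun k l => hcomm i j k l
    -- For a 1 × 1 matrix the relation reads (u − v)[s(u), s(v)] = [s(u), s(v)].
    have hss : CoeffCommute (s 0 0) (s 0 0) := by
      refine (commute_inU_inV_iff _ _).mp (sub_eq_zero.mp ?_)
      exact eq_zero_of_alphaUV_mul_eq_betaUV_mul (hs 0 0 0 0)
    have e1 : skewMinor (shiftHom A 1) M id id = D * (shiftHom A 1 ^ k) (s 0 0) := by
      have h := hcol id id
      rwa [Function.comp_id, append_castAdd_natAdd, skewMinor_one_by_one] at h
    have e2 : skewMinor (AlgHom.op (shiftHom A 1)) (opTranspose M) id id =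
        MulOpposite.op ((shiftHom A 1 ^ k) (s 0 0) * D) := by
      have h := hrow id id
      rw [Function.comp_id, append_castAdd_natAdd, skewMinor_one_by_one] at h
      rw [h, MulOpposite.op_mul, ← ih1, ← op_pow_apply]
      rfl
    rw [← shift_natCast] at e1 e2
    have hDs' : CoeffCommute D (Yangian.shift (k : ℂ) (s 0 0)) :=
      ((hDs 0 0).symm.shift_left _).symm
    refine ⟨?_, ?_, ?_⟩
    · rw [e1, e2, hDs'.commute.eq]
    · rw [e1]
      refine CoeffCommute.mul_left (CoeffCommute.mul_left ih2 hDs'.symm).symm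
        (CoeffCommute.mul_left hDs' ?_).symm
      exact (hss.shift_left _).symm.shift_left _
    · rw [e1, map_mul, ih3, constantCoeff_shift, one_mul]
      simpa using congrFun (congrFun hs1 0) 0

theorem IsRTT.isQuantumDet {k : ℕ} {M : Matrix (Fin k) (Fin k) A⟦X⟧} (hM : IsRTT M)
    (h1 : M.map PowerSeries.constantCoeff = 1) : IsQuantumDet M (qdet M) :=
  isQuantumDet_qdet hM.isSkewManin hM.isSkewManin_op (hM.qdet_induction h1).1

end QuantumDeterminant

/-! ### The generating matrix T(u) and the universal property of the Yangian -/

section Generators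

theorem coeff_T (n : ℕ) (i j : Fin n) (r : ℕ) : PowerSeries.coeff r (T n i j) = t n i j r := by
  simp [T]

theorem t_zero (n : ℕ) (i j : Fin n) : t n i j 0 = if i = j then 1 else 0 := by
  simp only [t, freeGen]
  split_ifs <;> simp

theorem T_map_constantCoeff (n : ℕ) : (T n).map PowerSeries.constantCoeff = 1 := by
  ext i j
  rw [Matrix.map_apply, ← PowerSeries.coeff_zero_eq_constantCoeff_apply, coeff_T, t_zero,
    Matrix.one_apply]

theorem t_relation (n : ℕ) (i j k l : Fin n) (r s : ℕ) :
    ⁅t n i j (r + 1), t n k l s⁆ - ⁅t n i j r, t n k l (s + 1)⁆ =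
      t n k j r * t n i l s - t n k j s * t n i l r := by
  have h := RingQuot.mkAlgHom_rel ℂ (Rel.mk i j k l r s)
  simp only [Ring.lie_def, map_sub, map_mul] at h
  exact h

theorem commute_ite_one_zero {R : Type*} [Ring R] (p : Prop) [Decidable p] (x : R) :
    Commute x (if p then 1 else 0) := by
  split_ifs
  · exact Commute.one_right x
  · exact Commute.zero_right x

theorem isRTT_T (n : ℕ) : IsRTT (T n) := by
  rw [isRTT_iff_coeff]
  intro i j k l
  simp only [coeff_T, t_zero]
  exact ⟨fun r => commute_ite_one_zero _ _, fun r => (commute_ite_one_zero _ _).symm,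
    t_relation n i j k l⟩

/-- The condition on constant terms is needed because t^{(0)} is fixed to be δ_ij and is not a free
generator. -/
theorem existsUnique_algHom_of_isRTT {A : Type*} [Ring A] [Algebra ℂ A] {m : ℕ}
    {M : Matrix (Fin m) (Fin m) A⟦X⟧} (hM : IsRTT M)
    (h1 : M.map PowerSeries.constantCoeff = 1) :
    ∃! φ : Yangian m →ₐ[ℂ] A, ∀ i j : Fin m,
      PowerSeries.map (φ : Yangian m →+* A) (T m i j) = M i j := by
  let ψ : FreeAlgebra ℂ (Fin m × Fin m × ℕ) →ₐ[ℂ] A :=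
    FreeAlgebra.lift ℂ fun x => PowerSeries.coeff (x.2.2 + 1) (M x.1 x.2.1)
  have hψ : ∀ i j r, ψ (freeGen m i j r) = PowerSeries.coeff r (M i j) := by
    intro i j r
    cases r with
    | zero =>
      have h := congrFun (congrFun h1 i) j
      rw [Matrix.map_apply, ← PowerSeries.coeff_zero_eq_constantCoeff_apply,
        Matrix.one_apply] at h
      rw [h, freeGen]
      split_ifs <;> simp
    | succ r => simp [ψ, freeGen]
  have hrel : ∀ ⦃x y⦄, Rel m x y → ψ x = ψ y := by
    rintro _ _ ⟨i, j, k, l, r, s⟩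
    have h := ((isRTT_iff_coeff.mp hM) i j k l).2.2 r s
    simpa only [Ring.lie_def, map_sub, map_mul, hψ] using h
  refine ⟨RingQuot.liftAlgHom ℂ ⟨ψ, hrel⟩, fun i j => ?_, fun φ hφ => ?_⟩
  · ext r
    rw [PowerSeries.coeff_map, coeff_T, t]
    exact (RingQuot.liftAlgHom_mkAlgHom_apply ℂ ψ hrel _).trans (hψ i j r)
  · refine RingQuot.ringQuot_ext' ℂ _ _ (FreeAlgebra.hom_ext (funext fun x => ?_))
    obtain ⟨i, j, r⟩ := x
    have h := congrArg (PowerSeries.coeff (r + 1)) (hφ i j)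
    rw [PowerSeries.coeff_map, coeff_T] at h
    have h2 : (RingQuot.liftAlgHom ℂ ⟨ψ, hrel⟩) (RingQuot.mkAlgHom ℂ (Rel m)
        (freeGen m i j (r + 1))) = ψ (freeGen m i j (r + 1)) :=
      RingQuot.liftAlgHom_mkAlgHom_apply ℂ ψ hrel _
    exact h.trans ((hψ i j (r + 1)).symm.trans h2.symm)

end Generators

/-! ### Multiplying a matrix by a commuting series -/

section Scaling

variable {A : Type*} [Ring A]

theorem IsRTT.mul_left {ι κ : Type*} {M : Matrix ι κ A⟦X⟧} (hM : IsRTT M) {g : A⟦X⟧}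
    (hgg : CoeffCommute g g) (hg : ∀ i j, CoeffCommute g (M i j)) :
    IsRTT (Matrix.of fun i j => g * M i j) := by
  have hUV : ∀ i j k l, inU (g * M i j) * inV (g * M k l) =
      inU g * inV g * (inU (M i j) * inV (M k l)) := by
    intro i j k l
    rw [map_mul, map_mul, mul_assoc, ← mul_assoc (inU (M i j)),
      (hg i j).symm.commute_inU_inV.eq]
    simp only [mul_assoc]
  have hVU : ∀ i j k l, inV (g * M k l) * inU (g * M i j) =
      inU g * inV g * (inV (M k l) * inU (M i j)) := by
    intro i j k l
    rw [map_mul, map_mul, mul_assoc, ← mul_assoc (inV (M k l)),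
      ← (hg k l).commute_inU_inV.eq, mul_assoc, ← mul_assoc (inV g),
      ← hgg.commute_inU_inV.eq]
  intro i j k l
  simp only [Matrix.of_apply, hUV, hVU, ← mul_sub]
  rw [← mul_assoc, alphaUV_comm, mul_assoc, hM i j k l, ← mul_assoc, ← betaUV_comm, mul_assoc]

variable [Algebra ℂ A]

theorem skewProd_replicate_mem {g h : A⟦X⟧} (hg : CoeffCommute g h) (m : ℕ) :
    CoeffCommute (skewProd (shiftHom A 1) (List.replicate m g)) h :=
  skewProd_mem (U := coeffCentralizer h) (fun _ hx => shift_mem_coeffCentralizer 1 hx)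
    (fun _ hx => List.eq_of_mem_replicate hx ▸ hg)

theorem skewProd_mul_left {g : A⟦X⟧} {l : List A⟦X⟧} (hl : ∀ x ∈ l, CoeffCommute g x) :
    skewProd (shiftHom A 1) (l.map fun x => g * x) =
      skewProd (shiftHom A 1) (List.replicate l.length g) * skewProd (shiftHom A 1) l := by
  induction l with
  | nil => simp
  | cons x l ih =>
    have hc := ((skewProd_replicate_mem (hl x (by simp)) l.length).shift_left 1).commute.eq
    rw [List.map_cons, skewProd_cons, ih fun y hy => hl y (by simp [hy]), List.length_cons,
      List.replicate_succ, skewProd_cons, skewProd_cons, map_mul, mul_assoc, mul_assoc,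
      ← mul_assoc x, shiftHom_apply, ← hc, mul_assoc]

theorem skewMinor_mul_left {ι κ : Type*} (M : Matrix ι κ A⟦X⟧) {g : A⟦X⟧} {k : ℕ} (c : Fin k → ι)
    (d : Fin k → κ) (hg : ∀ i j, CoeffCommute g (M i j)) :
    skewMinor (shiftHom A 1) (Matrix.of fun i j => g * M i j) c d =
      skewProd (shiftHom A 1) (List.replicate k g) * skewMinor (shiftHom A 1) M c d := by
  rw [skewMinor, skewMinor, Finset.mul_sum]
  refine Finset.sum_congr rfl fun σ _ => ?_
  have h := skewProd_mul_left (g := g) (l := List.ofFn fun a => M (c (σ a)) (d a)) (fun x hx => by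
    obtain ⟨a, rfl⟩ := (List.mem_ofFn' _ _).mp hx
    exact hg _ _)
  rw [List.length_ofFn, List.map_ofFn] at h
  rw [mul_smul_comm, ← h]
  rfl

theorem skewProd_map {P : Type*} [Ring P] [Algebra ℂ P] {τ ρ : P →ₐ[ℂ] P}
    (h : ∀ x, τ (ρ x) = ρ (τ x)) (l : List P) : skewProd τ (l.map ρ) = ρ (skewProd τ l) := by
  induction l with
  | nil => simp
  | cons x l ih => simp [ih, h]

theorem skewMinor_map {P ι κ : Type*} [Ring P] [Algebra ℂ P] {τ ρ : P →ₐ[ℂ] P}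
    (h : ∀ x, τ (ρ x) = ρ (τ x)) (M : Matrix ι κ P) {k : ℕ} (c : Fin k → ι) (d : Fin k → κ) :
    skewMinor τ (M.map ρ) c d = ρ (skewMinor τ M c d) := by
  rw [skewMinor, skewMinor, map_sum]
  refine Finset.sum_congr rfl fun σ _ => ?_
  rw [map_zsmul, ← skewProd_map h, List.map_ofFn]
  rfl

theorem prod_map_shift_range (g : A⟦X⟧) (m : ℕ) :
    ((List.range m).map fun k => shift ((k + 1 : ℕ) : ℂ) g).prod =
      shiftHom A 1 (skewProd (shiftHom A 1) (List.replicate m g)) := by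
  rw [← List.ofFn_const, skewProd_ofFn, map_list_prod, List.map_ofFn, List.ofFn_eq_map,
    ← List.map_coe_finRange_eq_range, List.map_map]
  congr 1
  refine List.map_congr_left fun a _ => ?_
  rw [Function.comp_apply, Function.comp_apply, shift_natCast, pow_succ', AlgHom.mul_apply]

end Scaling

/-! ### Reordering of index tuples -/

theorem skewMinor_eq_of_bijective {P : Type*} [Ring P] [Algebra ℂ P] {τ : P →ₐ[ℂ] P} {n k : ℕ}
    {M : Matrix (Fin n) (Fin n) P} (hM : IsSkewManin τ M) {c : Fin k → Fin n}
    (hc : Function.Bijective c) : skewMinor τ M c c = skewMinor τ M id id := by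
  obtain rfl : k = n := by simpa using Fintype.card_of_bijective hc
  exact skewMinor_comp_perm hM id id (Equiv.ofBijective c hc)

/-- The entries of T̃ list i before B, while elimination needs B first. The same rotation acts on
rows and columns, so its sign cancels in the minor. -/
theorem cons_eq_append_comp {X : Type*} {k : ℕ} (b : Fin k → X) (i : X) :
    (Fin.cons i b : Fin (k + 1) → X) = Fin.append b ![i] ∘ (finRotate (k + 1)).symm := by
  rw [Equiv.eq_comp_symm]
  ext a
  refine Fin.lastCases ?_ (fun a => ?_) a
  · rw [Function.comp_apply, finRotate_last, Fin.cons_zero]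
    exact (Fin.append_right b ![i] 0).symm
  · rw [Function.comp_apply, finRotate_apply, Fin.coeSucc_eq_succ, Fin.cons_succ]
    exact (Fin.append_left b ![i] a).symm

theorem sumElim_castLE_tupleB_injective {m n : ℕ} (h : m ≤ n) :
    Function.Injective (Sum.elim (Fin.castLE h) (tupleB h)) := by
  rintro (a | a) (b | b) hab <;> simp [tupleB, Fin.ext_iff] at hab ⊢ <;> omega

theorem append_tupleB_castLE_bijective {m n : ℕ} (h : m ≤ n) :
    Function.Bijective (Fin.append (tupleB h) (Fin.castLE h)) := by
  rw [Fintype.bijective_iff_injective_and_card]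
  refine ⟨fun a b => ?_, by simp [h]⟩
  refine Fin.addCases (fun a => ?_) (fun a => ?_) a <;>
    refine Fin.addCases (fun b => ?_) (fun b => ?_) b <;>
    simp [tupleB, Fin.ext_iff] <;> omega

end Yangian

/-! ### Assembly from the Schur complement of the block B -/

theorem mainTheorem7 (m n : ℕ) (hm : 1 ≤ m) (hmn : m ≤ n) :
    (∃! φ : Yangian m →ₐ[ℂ] Yangian n,
      ∀ i j : Fin m,
        PowerSeries.map (φ : Yangian m →+* Yangian n) (Yangian.T m i j) = Yangian.Ttilde hmn i j) ∧
    Yangian.IsQuantumDet (Yangian.T n) (Yangian.qdet (Yangian.T n)) ∧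
    Yangian.IsQuantumDet (Yangian.TBB hmn) (Yangian.qdet (Yangian.TBB hmn)) ∧
    Yangian.IsQuantumDet (Yangian.Ttilde hmn) (Yangian.qdet (Yangian.Ttilde hmn)) ∧
    Yangian.qdet (Yangian.Ttilde hmn) =
      Yangian.qdet (Yangian.T n) *
        ((List.range (m - 1)).map fun k =>
          Yangian.shift ((k + 1 : ℕ) : ℂ) (Yangian.qdet (Yangian.TBB hmn))).prod := by
  open Yangian in
  have hT := isRTT_T n
  have hT1 := T_map_constantCoeff n
  have hab := sumElim_castLE_tupleB_injective hmn
  have hB : IsRTT (TBB hmn) := hT.submatrix _ _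
  have hB1 : (TBB hmn).map PowerSeries.constantCoeff = 1 :=
    map_submatrix_eq_one hT1 (hab.comp Sum.inr_injective)
  obtain ⟨s, hs, hs1, hcomm, hcol, -⟩ := hT.exists_skewMinor_append hT1 _ _ hab
  set τ := shiftHom (Yangian n) 1
  set g := qdet (TBB hmn) with hg
  have hgB : skewMinor τ (T n) (tupleB hmn) (tupleB hmn) = g :=
    (quantumMinor_eq_skewMinor (TBB hmn) id id).symm
  obtain ⟨-, hgg, hg1⟩ := hB.qdet_induction hB1
  rw [← quantumMinor_eq_skewMinor] at hgg hg1
  have hgs : ∀ i j, CoeffCommute g (s i j) := fun i j => by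
    rw [← hgB]
    exact CoeffCommute.skewMinor_left fun k l => hcomm i j k l
  set k : ℂ := ((n - m : ℕ) : ℂ)
  have hgs' : ∀ i j, CoeffCommute g (s.map (shift k) i j) := fun i j =>
    ((hgs i j).symm.shift_left k).symm
  -- Factorization of minors with a single extra row and column; the shift k = n − m comes from the
  -- size of B.
  have htilde : Ttilde hmn = Matrix.of fun i j => g * s.map (shift k) i j := by
    ext1 i j
    rw [Ttilde, Matrix.of_apply, Matrix.of_apply, quantumMinor_eq_skewMinor, tupleConsB,
      tupleConsB, cons_eq_append_comp, cons_eq_append_comp, skewMinor_comp_perm hT.isSkewManin]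
    have h := hcol ![i] ![j]
    rw [hgB, skewMinor_one_by_one, ← shift_natCast] at h
    convert h using 2 <;> congr 1 <;> ext a <;> simp
  have htRTT : IsRTT (Ttilde hmn) := by
    rw [htilde]
    exact (hs.shift k).mul_left hgg hgs'
  have ht1 : (Ttilde hmn).map PowerSeries.constantCoeff = 1 := by
    ext1 i j
    rw [htilde, Matrix.map_apply, Matrix.of_apply, map_mul]
    refine (congrArg₂ (· * ·) hg1 (constantCoeff_shift _ _)).trans ?_
    rw [one_mul]
    exact congrFun (congrFun hs1 i) j
  refine ⟨existsUnique_algHom_of_isRTT htRTT ht1, hT.isQuantumDet hT1, hB.isQuantumDet hB1,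
    htRTT.isQuantumDet ht1, ?_⟩
  set S := shift k (skewMinor τ s id id) with hS
  have hqT : qdet (T n) = g * S := by
    have h := hcol id id
    rw [Function.comp_id, hgB, ← shift_natCast] at h
    rw [qdet, quantumMinor_eq_skewMinor,
      ← skewMinor_eq_of_bijective hT.isSkewManin (append_tupleB_castLE_bijective hmn), h]
  have hgS : CoeffCommute g S :=
    ((CoeffCommute.skewMinor_left fun i j => (hgs i j).symm).shift_left k).symm
  obtain ⟨m, rfl⟩ : ∃ m', m = m' + 1 := ⟨m - 1, by omega⟩
  have hmap : skewMinor τ (s.map (shift k)) id id = S :=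
    skewMinor_map (τ := τ) (ρ := shiftHom _ k)
      (fun x => by simp only [τ, shiftHom_apply, shift_shift, add_comm]) s id id
  rw [hqT, qdet, quantumMinor_eq_skewMinor, htilde, skewMinor_mul_left _ _ _ hgs', hmap,
    Nat.add_sub_cancel, prod_map_shift_range, List.replicate_succ, skewProd_cons, mul_assoc,
    mul_assoc]
  congr 1
  -- What remains is to move g(u − 1) ⋯ g(u − m), for the renamed m, one less than the original,
  -- past S.
  exact ((skewProd_replicate_mem hgS m).shift_left 1).commute.eq
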